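/- **Theorem.** The *label* of a point $p=(p_x,p_y)$ in the plane is the closed unit square $[p_x,p_x+1]\times[p_y,p_y+1]$ with lower left corner $p$, and the *leader* of $p$ is the horizontal half-line $\{(x,p_y) : x\le p_x\}$ that goes from $p$ to the left. A *mixed labeling* of a finite point set $\mathcal P$ is a partition of $\mathcal P$ into a set $\mathcal I$ of internally labeled points and a set $\mathcal E$ of externally labeled points such that no two labels of points in $\mathcal I$ intersect, no two leaders of points in $\mathcal E$ intersect, and no label of a point in $\mathcal I$ intersects a leader of a point in $\mathcal E$. There is an algorithm that, given any set $\mathcal P$ of $n\ge 2$ points in the plane with pairwise distinct $y$-coordinates, computes a mixed labeling of $\mathcal P$ with the maximum possible number $|\mathcal I|$ of internally labeled points in $O(n^3\log n+n^3\delta)$ time and $O(n^2\delta)$ space, where $\delta=\min\{n,1/d_{\min}\}$ and $d_{\min}$ is the smallest distance between two points of $\mathcal P$. The model of computation is a unit-cost real RAM: real numbers can be added, subtracted, multiplied, divided and compared exactly, but not rounded; the other words are natural numbers with $O(\log n)$ bits. The input is read-only and the output write-only; space is the number of cells of working memory used in addition to a constant number of registers. -/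

import Mathlib

noncomputable section

/-! ## A unit-cost real RAM

Structured programs over finitely many registers (those named in the program) and two random-access
working memories, one for natural numbers and one for real numbers.  The input is a read-only list of
reals, the output a write-only array of natural numbers.  A machine comes with a word limit `W`
(every natural number that it computes is smaller than `W`) and a memory limit `m` (only the working
memory cells with an address below `m` exist).  An instruction that violates a limit, divides by
zero or reads beyond the end of the input has no result, and the run cannot be completed. -/

namespace RealRAM

/-- The four arithmetic operations.  On natural numbers, subtraction is truncated and division rounds
down; on reals they are exact. -/
inductive ArithOp
  | add
  | sub
  | mul
  | div

def ArithOp.evalNat : ArithOp → ℕ → ℕ → Option ℕ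
  | .add, a, b => some (a + b)
  | .sub, a, b => some (a - b)
  | .mul, a, b => some (a * b)
  | .div, a, b => if b = 0 then none else some (a / b)

open Classical in
def ArithOp.evalReal : ArithOp → ℝ → ℝ → Option ℝ
  | .add, a, b => some (a + b)
  | .sub, a, b => some (a - b)
  | .mul, a, b => some (a * b)
  | .div, a, b => if b = 0 then none else some (a / b)

/-- The configuration of the machine. -/
structure State where
  natReg : ℕ → ℕ
  realReg : ℕ → ℝ
  natMem : ℕ → ℕ
  realMem : ℕ → ℝ
  input : List ℝ
  output : ℕ → ℕ

/-- Primitive instructions.  The arguments (except the constants) are numbers of registers: `d` is a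
destination, `a` and `b` are operands.  There is no conversion of reals to natural numbers. -/
inductive Instr
  /-- `natReg d := k` -/
  | natConst (d k : ℕ)
  /-- `natReg d := natReg a op natReg b` -/
  | natArith (op : ArithOp) (d a b : ℕ)
  /-- `natReg d := natMem (natReg a)` -/
  | natLoad (d a : ℕ)
  /-- `natMem (natReg a) := natReg b` -/
  | natStore (a b : ℕ)
  /-- `realReg d := z` -/
  | realConst (d : ℕ) (z : ℤ)
  /-- `realReg d := realReg a op realReg b` -/
  | realArith (op : ArithOp) (d a b : ℕ)
  /-- `realReg d := realMem (natReg a)` -/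
  | realLoad (d a : ℕ)
  /-- `realMem (natReg a) := realReg b` -/
  | realStore (a b : ℕ)
  /-- `realReg d := input (natReg a)` -/
  | readInput (d a : ℕ)
  /-- `output (natReg a) := natReg b` -/
  | writeOutput (a b : ℕ)

def State.setNat (s : State) (d v : ℕ) : State :=
  { s with natReg := Function.update s.natReg d v }

def State.setReal (s : State) (d : ℕ) (v : ℝ) : State :=
  { s with realReg := Function.update s.realReg d v }

/-- The effect of one instruction on a machine with word limit `W` and memory limit `m`. -/
def Instr.step (W m : ℕ) : Instr → State → Option State
  | .natConst d k, s => if k < W then some (s.setNat d k) else none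
  | .natArith op d a b, s =>
      (op.evalNat (s.natReg a) (s.natReg b)).bind fun v =>
        if v < W then some (s.setNat d v) else none
  | .natLoad d a, s =>
      if s.natReg a < m then some (s.setNat d (s.natMem (s.natReg a))) else none
  | .natStore a b, s =>
      if s.natReg a < m then
        some { s with natMem := Function.update s.natMem (s.natReg a) (s.natReg b) }
      else none
  | .realConst d z, s => some (s.setReal d (z : ℝ))
  | .realArith op d a b, s =>
      (op.evalReal (s.realReg a) (s.realReg b)).map fun v => s.setReal d v
  | .realLoad d a, s =>
      if s.natReg a < m then some (s.setReal d (s.realMem (s.natReg a))) else none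
  | .realStore a b, s =>
      if s.natReg a < m then
        some { s with realMem := Function.update s.realMem (s.natReg a) (s.realReg b) }
      else none
  | .readInput d a, s => (s.input[s.natReg a]?).map fun v => s.setReal d v
  | .writeOutput a b, s =>
      some { s with output := Function.update s.output (s.natReg a) (s.natReg b) }

/-- Comparisons of the contents of two registers. -/
inductive Test
  | natLt (a b : ℕ)
  | natEq (a b : ℕ)
  | realLt (a b : ℕ)
  | realEq (a b : ℕ)

def Test.holds : Test → State → Prop
  | .natLt a b, s => s.natReg a < s.natReg b
  | .natEq a b, s => s.natReg a = s.natReg b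
  | .realLt a b, s => s.realReg a < s.realReg b
  | .realEq a b, s => s.realReg a = s.realReg b

inductive Program
  | skip
  | instr (i : Instr)
  | seq (p q : Program)
  | ite (b : Test) (p q : Program)
  | loop (b : Test) (p : Program)

/-- `Runs W m p s t s'`: on a machine with word limit `W` and memory limit `m`, the program `p`,
started in state `s`, halts in state `s'` after executing exactly `t` instructions and comparisons. -/
inductive Runs (W m : ℕ) : Program → State → ℕ → State → Prop
  | skip (s : State) : Runs W m .skip s 0 s
  | instr (i : Instr) (s s' : State) (h : i.step W m s = some s') : Runs W m (.instr i) s 1 s'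
  | seq (p q : Program) (s₁ s₂ s₃ : State) (t₁ t₂ : ℕ)
      (h₁ : Runs W m p s₁ t₁ s₂) (h₂ : Runs W m q s₂ t₂ s₃) :
      Runs W m (.seq p q) s₁ (t₁ + t₂) s₃
  | ite_true (b : Test) (p q : Program) (s s' : State) (t : ℕ)
      (hb : b.holds s) (h : Runs W m p s t s') : Runs W m (.ite b p q) s (t + 1) s'
  | ite_false (b : Test) (p q : Program) (s s' : State) (t : ℕ)
      (hb : ¬ b.holds s) (h : Runs W m q s t s') : Runs W m (.ite b p q) s (t + 1) s'
  | loop_true (b : Test) (p : Program) (s₁ s₂ s₃ : State) (t₁ t₂ : ℕ)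
      (hb : b.holds s₁) (h₁ : Runs W m p s₁ t₁ s₂) (h₂ : Runs W m (.loop b p) s₂ t₂ s₃) :
      Runs W m (.loop b p) s₁ (t₁ + t₂ + 1) s₃
  | loop_false (b : Test) (p : Program) (s : State)
      (hb : ¬ b.holds s) : Runs W m (.loop b p) s 1 s

/-- The start configuration: the size parameter `n` is in natural-number register `0`, the input is
`l`, and everything else is zero. -/
def State.init (n : ℕ) (l : List ℝ) : State where
  natReg := Function.update (fun _ => 0) 0 n
  realReg := fun _ => 0
  natMem := fun _ => 0
  realMem := fun _ => 0
  input := l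
  output := fun _ => 0

end RealRAM

/-! ## Mixed labelings with leaders going to the left -/

namespace MixedLabeling

/-- The Euclidean plane; coordinate `0` is `x` (to the right), coordinate `1` is `y` (upwards). -/
abbrev Plane : Type := EuclideanSpace ℝ (Fin 2)

/-- The `x`-coordinate. -/
abbrev xc (p : Plane) : ℝ := p 0

/-- The `y`-coordinate. -/
abbrev yc (p : Plane) : ℝ := p 1

/-- The internal label of `p`: the (closed) unit square with lower left corner `p`. -/
def label (p : Plane) : Set Plane :=
  {q | xc p ≤ xc q ∧ xc q ≤ xc p + 1 ∧ yc p ≤ yc q ∧ yc q ≤ yc p + 1}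

/-- The leader of `p`: the horizontal half-line that starts at `p` and goes to the left. -/
def leader (p : Plane) : Set Plane :=
  {q | yc q = yc p ∧ xc q ≤ xc p}

/-- A mixed labeling of the points `P i`: a partition of the points into internally labeled points
(indices in `I`) and externally labeled points (indices in `E`) such that no two labels, no two
leaders, and no label and leader intersect. -/
structure IsLabeling {n : ℕ} (P : Fin n → Plane) (I E : Finset (Fin n)) : Prop where
  partition : IsCompl I E
  labels : ∀ i ∈ I, ∀ j ∈ I, i ≠ j → Disjoint (label (P i)) (label (P j))
  leaders : ∀ i ∈ E, ∀ j ∈ E, i ≠ j → Disjoint (leader (P i)) (leader (P j))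
  label_leader : ∀ i ∈ I, ∀ j ∈ E, Disjoint (label (P i)) (leader (P j))

/-- A labeling with the maximum number of internally labeled points. -/
def IsMaxLabeling {n : ℕ} (P : Fin n → Plane) (I E : Finset (Fin n)) : Prop :=
  IsLabeling P I E ∧ ∀ I' E' : Finset (Fin n), IsLabeling P I' E' → I'.card ≤ I.card

/-- The smallest distance between two of the points (for `n ≥ 2`, the minimum of a nonempty finite
set). -/
def minDist {n : ℕ} (P : Fin n → Plane) : ℝ :=
  sInf {d : ℝ | ∃ i j : Fin n, i ≠ j ∧ d = dist (P i) (P j)}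

/-- `δ = min {n, 1 / d_min}`. -/
def density {n : ℕ} (P : Fin n → Plane) : ℝ :=
  min (n : ℝ) (1 / minDist P)

/-- The points as an input list: the `n` `x`-coordinates followed by the `n` `y`-coordinates. -/
def encode {n : ℕ} (P : Fin n → Plane) : List ℝ :=
  List.ofFn (fun i => xc (P i)) ++ List.ofFn (fun i => yc (P i))

end MixedLabeling

end

/-! Leaders of points at distinct heights never meet. A labeling is therefore a set of internal
points that contains no two points with intersecting labels and is closed under forcing: `i` forces
`j` when the leader of `j` meets the label of `i`. Forcing always goes upward.

Let R(m) consist of the points reached from m by forcing, and let S(m) be a largest valid set with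
lowest point m. If such a set exists, one is R(m) alone or R(m) ∪ S(q) for some q above m, and only
conflicts that involve R(m) need to be checked. Indeed, take a valid set I with lowest point m that
is not contained in R(m), let q be the lowest point of I outside R(m), and replace the part of I
from q upward by S(q). Below q the set I lies in R(m), so no cardinality is lost
(`exists_free_card_le`). No conflict arises between i in R(m) and p in S(q): if i is above q, the
forcing chain from m to i jumps over the height of q without reaching q, so q reaches i too
(`Reach.of_not_reach`) and i lies in S(q); if i is below q, then i forces q, q forces p, or i and q
conflict (`Conf.between`), and each case is impossible or puts p into I.

Treating the points from top to bottom gives n rounds. A round obtains R(m) from the rows of higher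
points, marks once all points in conflict with R(m), and can then score each of the n candidates in
linear time. This is O(n³) time and O(n²) cells; the time fits because log n ≥ 1/2 for n ≥ 2.

The space bound needs a case distinction, since δ can be arbitrarily small. If two labels intersect,
then d_min ≤ 2, so δ ≥ 1/2 and n² ≤ 2n²δ. Otherwise all points are labeled internally, and both the
test and the output use registers only (`runsIn_of_not_conf`).

The algorithm is written in a small language of expressions and statements that compiles to the
machine. Limits on words and addresses are checked syntactically, and the exponent of the running
time is the nesting depth of loops and sums. -/

namespace RealRAM

/-! ### Time-bounded runs and rules for composing them. -/

/-- `p` leads from `s` to `s'` within `T` steps. -/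
def RunsIn (W m : ℕ) (p : Program) (s : State) (T : ℕ) (s' : State) : Prop :=
  ∃ t ≤ T, Runs W m p s t s'

namespace RunsIn

variable {W m : ℕ} {p q : Program} {s s₁ s₂ s₃ : State} {T T₁ T₂ : ℕ}

theorem mono (h : RunsIn W m p s₁ T₁ s₂) (hT : T₁ ≤ T₂) : RunsIn W m p s₁ T₂ s₂ := by
  obtain ⟨t, ht, hr⟩ := h
  exact ⟨t, ht.trans hT, hr⟩

theorem seq (h₁ : RunsIn W m p s₁ T₁ s₂) (h₂ : RunsIn W m q s₂ T₂ s₃) :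
    RunsIn W m (.seq p q) s₁ (T₁ + T₂) s₃ := by
  obtain ⟨t₁, ht₁, hr₁⟩ := h₁
  obtain ⟨t₂, ht₂, hr₂⟩ := h₂
  exact ⟨t₁ + t₂, add_le_add ht₁ ht₂, .seq _ _ _ _ _ _ _ hr₁ hr₂⟩

theorem instr {i : Instr} (h : i.step W m s₁ = some s₂) : RunsIn W m (.instr i) s₁ 1 s₂ :=
  ⟨1, le_rfl, .instr _ _ _ h⟩

theorem natConst {d k : ℕ} (h : k < W) :
    RunsIn W m (.instr (.natConst d k)) s 1 (s.setNat d k) :=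
  instr (by simp [Instr.step, h])

theorem natArith {o : ArithOp} {d a b v : ℕ}
    (hv : o.evalNat (s.natReg a) (s.natReg b) = some v) (h : v < W) :
    RunsIn W m (.instr (.natArith o d a b)) s 1 (s.setNat d v) :=
  instr (by simp [Instr.step, hv, h])

theorem natAdd {d a b : ℕ} (h : s.natReg a + s.natReg b < W) :
    RunsIn W m (.instr (.natArith .add d a b)) s 1 (s.setNat d (s.natReg a + s.natReg b)) :=
  natArith rfl h

theorem ite_true {b : Test} (hb : b.holds s₁) (h : RunsIn W m p s₁ T s₂) :
    RunsIn W m (.ite b p q) s₁ (T + 1) s₂ := by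
  obtain ⟨t, ht, hr⟩ := h
  exact ⟨t + 1, by omega, .ite_true _ _ _ _ _ _ hb hr⟩

theorem ite_false {b : Test} (hb : ¬ b.holds s₁) (h : RunsIn W m q s₁ T s₂) :
    RunsIn W m (.ite b p q) s₁ (T + 1) s₂ := by
  obtain ⟨t, ht, hr⟩ := h
  exact ⟨t + 1, by omega, .ite_false _ _ _ _ _ _ hb hr⟩

/-- The rule for loops in which register `v` counts up to the number in register `0`. -/
theorem count {v n : ℕ} (Inv : ℕ → State → Prop)
    (hreg : ∀ k s, Inv k s → s.natReg v = k ∧ s.natReg 0 = n)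
    (hstep : ∀ k < n, ∀ s, Inv k s → ∃ s', RunsIn W m p s T s' ∧ Inv (k + 1) s')
    (h0 : Inv 0 s) :
    ∃ s', RunsIn W m (.loop (.natLt v 0) p) s (n * (T + 1) + 1) s' ∧ Inv n s' := by
  suffices H : ∀ d k s, k + d = n → Inv k s →
      ∃ s', RunsIn W m (.loop (.natLt v 0) p) s (d * (T + 1) + 1) s' ∧ Inv n s' from
    H n 0 s (by omega) h0
  intro d
  induction d with
  | zero =>
    intro k s hk hs
    obtain ⟨hv, hn⟩ := hreg k s hs
    obtain rfl : k = n := by omega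
    refine ⟨s, ⟨1, by omega, .loop_false _ _ _ ?_⟩, hs⟩
    simp [Test.holds, hv, hn]
  | succ d ih =>
    intro k s hk hs
    obtain ⟨hv, hn⟩ := hreg k s hs
    obtain ⟨s₁, ⟨t₁, ht₁, hr₁⟩, hs₁⟩ := hstep k (by omega) s hs
    obtain ⟨s₂, ⟨t₂, ht₂, hr₂⟩, hs₂⟩ := ih (k + 1) s₁ (by omega) hs₁
    refine ⟨s₂, ⟨t₁ + t₂ + 1, ?_, .loop_true _ _ _ _ _ _ _ ?_ hr₁ hr₂⟩, hs₂⟩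
    · rw [Nat.succ_mul]; omega
    · simp only [Test.holds, hv, hn]; omega

end RunsIn

@[simp] theorem State.natReg_setNat (s : State) (d v : ℕ) :
    (s.setNat d v).natReg = Function.update s.natReg d v := rfl
@[simp] theorem State.natMem_setNat (s : State) (d v : ℕ) : (s.setNat d v).natMem = s.natMem := rfl
@[simp] theorem State.input_setNat (s : State) (d v : ℕ) : (s.setNat d v).input = s.input := rfl
@[simp] theorem State.output_setNat (s : State) (d v : ℕ) : (s.setNat d v).output = s.output := rfl
@[simp] theorem State.natReg_setReal (s : State) (d : ℕ) (v : ℝ) :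
    (s.setReal d v).natReg = s.natReg := rfl
@[simp] theorem State.input_setReal (s : State) (d : ℕ) (v : ℝ) :
    (s.setReal d v).input = s.input := rfl
@[simp] theorem State.realReg_setReal (s : State) (d : ℕ) (v : ℝ) :
    (s.setReal d v).realReg = Function.update s.realReg d v := rfl

/-! ### Expressions with natural-number values -/

/-- Expressions over the size parameter `size`, variables (kept in registers), memory cells and
comparisons of input numbers. -/
inductive Expr
  | const (k : ℕ)
  | size
  | var (r : ℕ)
  | op (o : ArithOp) (e₁ e₂ : Expr)
  | load (e : Expr)
  | lt (e₁ e₂ : Expr)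
  | eq (e₁ e₂ : Expr)
  /-- Is the input number at `e₁` smaller than `z` plus the input number at `e₂`? -/
  | cmp (z : ℤ) (e₁ e₂ : Expr)
  /-- The sum of `e` over all `v < size`. -/
  | sum (v : ℕ) (e : Expr)

namespace Expr

/-- The value of an expression; truth values are `0` and `1`. -/
noncomputable def eval (n : ℕ) (l : List ℝ) : Expr → (ℕ → ℕ) → (ℕ → ℕ) → ℕ
  | const k, _, _ => k
  | size, _, _ => n
  | var r, ρ, _ => ρ r
  | op o e₁ e₂, ρ, μ => (o.evalNat (e₁.eval n l ρ μ) (e₂.eval n l ρ μ)).getD 0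
  | load e, ρ, μ => μ (e.eval n l ρ μ)
  | lt e₁ e₂, ρ, μ => if e₁.eval n l ρ μ < e₂.eval n l ρ μ then 1 else 0
  | eq e₁ e₂, ρ, μ => if e₁.eval n l ρ μ = e₂.eval n l ρ μ then 1 else 0
  | cmp z e₁ e₂, ρ, μ =>
      if l.getD (e₁.eval n l ρ μ) 0 < l.getD (e₂.eval n l ρ μ) 0 + z then 1 else 0
  | sum v e, ρ, μ => ∑ k ∈ Finset.range n, e.eval n l (Function.update ρ v k) μ

/-- A bound for the value, if all variables and all memory cells hold numbers below `n`. -/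
def bound (n : ℕ) : Expr → ℕ
  | const k => k
  | size => n
  | var _ => n - 1
  | op .add e₁ e₂ => e₁.bound n + e₂.bound n
  | op .sub e₁ _ => e₁.bound n
  | op .mul e₁ e₂ => e₁.bound n * e₂.bound n
  | op .div e₁ _ => e₁.bound n
  | load _ => n - 1
  | lt _ _ => 1
  | eq _ _ => 1
  | cmp _ _ _ => 1
  | sum _ e => n * e.bound n

/-- The expression `e` with free variables among `V` can be evaluated with the scratch registers from
`b` on, word limit `W` and memory limit `m`. -/
def Ok (W m n : ℕ) : List ℕ → ℕ → Expr → Prop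
  | _, _, const k => k < W
  | _, _, size => True
  | V, _, var r => r ∈ V
  | V, b, op o e₁ e₂ => o ≠ .div ∧ bound n (op o e₁ e₂) < W ∧ Ok W m n V b e₁ ∧ Ok W m n V (b + 1) e₂
  | V, b, load e => e.bound n < m ∧ Ok W m n V b e
  | V, b, lt e₁ e₂ => Ok W m n V b e₁ ∧ Ok W m n V (b + 1) e₂
  | V, b, eq e₁ e₂ => Ok W m n V b e₁ ∧ Ok W m n V (b + 1) e₂
  | V, b, cmp _ e₁ e₂ => e₁.bound n < 2 * n ∧ e₂.bound n < 2 * n ∧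
      Ok W m n V b e₁ ∧ Ok W m n V (b + 1) e₂
  | V, b, sum v e => b ≤ v ∧ n * e.bound n < W ∧ Ok W m n (v :: V) (v + 2) e

/-- The program that puts the value of an expression into register `b`, with scratch registers from
`b` on. -/
def compile : Expr → ℕ → Program
  | const k, b => .instr (.natConst b k)
  -- The machine has no move instruction, so a register is copied by adding it to zero.
  | size, b => .seq (.instr (.natConst b 0)) (.instr (.natArith .add b 0 b))
  | var r, b => .seq (.instr (.natConst b 0)) (.instr (.natArith .add b r b))
  | op o e₁ e₂, b => .seq (e₁.compile b) (.seq (e₂.compile (b + 1))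
      (.instr (.natArith o b b (b + 1))))
  | load e, b => .seq (e.compile b) (.instr (.natLoad b b))
  | lt e₁ e₂, b => .seq (e₁.compile b) (.seq (e₂.compile (b + 1))
      (.ite (.natLt b (b + 1)) (.instr (.natConst b 1)) (.instr (.natConst b 0))))
  | eq e₁ e₂, b => .seq (e₁.compile b) (.seq (e₂.compile (b + 1))
      (.ite (.natEq b (b + 1)) (.instr (.natConst b 1)) (.instr (.natConst b 0))))
  | cmp z e₁ e₂, b => .seq (e₁.compile b) (.seq (e₂.compile (b + 1))
      (.seq (.instr (.readInput 0 b)) (.seq (.instr (.readInput 1 (b + 1)))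
      (.seq (.instr (.realConst 2 z)) (.seq (.instr (.realArith .add 1 1 2))
      (.ite (.realLt 0 1) (.instr (.natConst b 1)) (.instr (.natConst b 0))))))))
  -- Register `v` counts, `v + 1` accumulates, and `v + 2` holds first the summand and then the
  -- increment 1.
  | sum v e, b => .seq (.instr (.natConst v 0)) (.seq (.instr (.natConst (v + 1) 0))
      (.seq (.loop (.natLt v 0) (.seq (e.compile (v + 2))
        (.seq (.instr (.natArith .add (v + 1) (v + 1) (v + 2)))
        (.seq (.instr (.natConst (v + 2) 1)) (.instr (.natArith .add v v (v + 2)))))))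
      (.seq (.instr (.natConst b 0)) (.instr (.natArith .add b b (v + 1))))))

/-- The nesting depth of sums: the degree of the running time. -/
def deg : Expr → ℕ
  | const _ => 0
  | size => 0
  | var _ => 0
  | op _ e₁ e₂ => max e₁.deg e₂.deg
  | load e => e.deg
  | lt e₁ e₂ => max e₁.deg e₂.deg
  | eq e₁ e₂ => max e₁.deg e₂.deg
  | cmp _ e₁ e₂ => max e₁.deg e₂.deg
  | sum _ e => e.deg + 1

/-- The constant factor of the running time. -/
def coef : Expr → ℕ
  | const _ => 1
  | size => 2
  | var _ => 2
  | op _ e₁ e₂ => e₁.coef + e₂.coef + 1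
  | load e => e.coef + 1
  | lt e₁ e₂ => e₁.coef + e₂.coef + 2
  | eq e₁ e₂ => e₁.coef + e₂.coef + 2
  | cmp _ e₁ e₂ => e₁.coef + e₂.coef + 6
  | sum _ e => e.coef + 9

variable {W m n : ℕ} {l : List ℝ}

theorem eval_congr (e : Expr) {V : List ℕ} {b : ℕ} {ρ ρ' μ : ℕ → ℕ} (hok : e.Ok W m n V b)
    (h : ∀ r ∈ V, ρ r = ρ' r) : e.eval n l ρ μ = e.eval n l ρ' μ := by
  induction e generalizing V b ρ ρ' with
  | const k => rfl
  | size => rfl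
  | var r => exact h r hok
  | op o e₁ e₂ ih₁ ih₂ => simp only [eval]; rw [ih₁ hok.2.2.1 h, ih₂ hok.2.2.2 h]
  | load e ih => simp only [eval]; rw [ih hok.2 h]
  | lt e₁ e₂ ih₁ ih₂ => simp only [eval]; rw [ih₁ hok.1 h, ih₂ hok.2 h]
  | eq e₁ e₂ ih₁ ih₂ => simp only [eval]; rw [ih₁ hok.1 h, ih₂ hok.2 h]
  | cmp z e₁ e₂ ih₁ ih₂ => simp only [eval]; rw [ih₁ hok.2.2.1 h, ih₂ hok.2.2.2 h]
  | sum v e ih =>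
    refine Finset.sum_congr rfl fun k _ => ih hok.2.2 fun r hr => ?_
    by_cases hrv : r = v
    · simp [hrv]
    · simp only [Function.update_of_ne hrv]
      exact h r ((List.mem_cons.1 hr).resolve_left hrv)

/-- This makes `Ok` a static check: a limit that holds for `bound` holds for every value met during
a run. -/
theorem eval_le_bound (e : Expr) {V : List ℕ} {b : ℕ} {ρ μ : ℕ → ℕ} (hok : e.Ok W m n V b)
    (hρ : ∀ r ∈ V, ρ r < n) (hμ : ∀ a, μ a < n) : e.eval n l ρ μ ≤ e.bound n := by
  induction e generalizing V b ρ with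
  | const k => exact le_rfl
  | size => exact le_rfl
  | var r => exact Nat.le_pred_of_lt (hρ r hok)
  | op o e₁ e₂ ih₁ ih₂ =>
    have h₁ := ih₁ hok.2.2.1 hρ
    have h₂ := ih₂ hok.2.2.2 hρ
    cases o with
    | add => exact add_le_add h₁ h₂
    | sub => exact (Nat.sub_le _ _).trans h₁
    | mul => exact Nat.mul_le_mul h₁ h₂
    | div => exact absurd rfl hok.1
  | load e ih => exact Nat.le_pred_of_lt (hμ _)
  | lt e₁ e₂ ih₁ ih₂ => simp only [eval, bound]; split <;> simp
  | eq e₁ e₂ ih₁ ih₂ => simp only [eval, bound]; split <;> simp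
  | cmp z e₁ e₂ ih₁ ih₂ => simp only [eval, bound]; split <;> simp
  | sum v e ih =>
    refine (Finset.sum_le_card_nsmul _ _ (e.bound n) fun k hk => ih hok.2.2 fun r hr => ?_).trans
      (by simp [bound])
    by_cases hrv : r = v
    · simpa [hrv] using hk
    · simp only [Function.update_of_ne hrv]
      exact hρ r ((List.mem_cons.1 hr).resolve_left hrv)

end Expr

/-! ### Correctness and running time of compiled expressions. -/

/-- Everything in `s'` is as in `s`, except perhaps for the real registers and the natural-number
registers from `b` on. -/
structure SameBelow (b : ℕ) (s s' : State) : Prop where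
  reg : ∀ r < b, s'.natReg r = s.natReg r
  mem : s'.natMem = s.natMem
  input : s'.input = s.input
  output : s'.output = s.output

theorem SameBelow.trans {b : ℕ} {s s' s'' : State} (h : SameBelow b s s') (h' : SameBelow b s' s'') :
    SameBelow b s s'' :=
  ⟨fun r hr => (h'.reg r hr).trans (h.reg r hr), h'.mem.trans h.mem, h'.input.trans h.input,
    h'.output.trans h.output⟩

theorem SameBelow.mono {b b' : ℕ} {s s' : State} (h : SameBelow b' s s') (hb : b ≤ b') :
    SameBelow b s s' :=
  ⟨fun r hr => h.reg r (hr.trans_le hb), h.mem, h.input, h.output⟩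

theorem SameBelow.setNat {b d v : ℕ} {s s' : State} (h : SameBelow b s s') (hd : b ≤ d) :
    SameBelow b s (s'.setNat d v) :=
  ⟨fun r hr => by rw [← h.reg r hr]; simp [Function.update_of_ne (hr.trans_le hd).ne],
    h.mem, h.input, h.output⟩

theorem SameBelow.setReal {b d : ℕ} {v : ℝ} {s s' : State} (h : SameBelow b s s') :
    SameBelow b s (s'.setReal d v) := ⟨h.reg, h.mem, h.input, h.output⟩

theorem SameBelow.rfl {b : ℕ} {s : State} : SameBelow b s s :=
  ⟨fun _ _ => Eq.refl _, Eq.refl _, Eq.refl _, Eq.refl _⟩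

/-- The state `s` is a sound starting point for code with variables `V` and scratch registers from
`b` on. -/
structure Ready (n : ℕ) (l : List ℝ) (V : List ℕ) (b : ℕ) (s : State) : Prop where
  vars : ∀ r ∈ V, r < b ∧ s.natReg r < n
  base : 0 < b
  size : s.natReg 0 = n
  input : s.input = l
  length : l.length = 2 * n
  mem : ∀ a, s.natMem a < n

theorem Ready.same {n : ℕ} {l : List ℝ} {V : List ℕ} {b : ℕ} {s s' : State} (h : Ready n l V b s)
    (h' : SameBelow b s s') : Ready n l V b s' where
  vars r hr := ⟨(h.vars r hr).1, by rw [h'.reg r (h.vars r hr).1]; exact (h.vars r hr).2⟩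
  base := h.base
  size := by rw [h'.reg 0 h.base, h.size]
  input := by rw [h'.input, h.input]
  length := h.length
  mem := by rw [h'.mem]; exact h.mem

theorem Ready.mono {n : ℕ} {l : List ℝ} {V : List ℕ} {b b' : ℕ} {s : State} (h : Ready n l V b s)
    (hb : b ≤ b') : Ready n l V b' s where
  vars r hr := ⟨(h.vars r hr).1.trans_le hb, (h.vars r hr).2⟩
  base := h.base.trans_le hb
  size := h.size
  input := h.input
  length := h.length
  mem := h.mem

theorem Ready.cons {n : ℕ} {l : List ℝ} {V : List ℕ} {b v : ℕ} {s : State} (h : Ready n l V b s)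
    (hv : s.natReg v < n) (hb : v < b) : Ready n l (v :: V) b s where
  vars r hr := by
    rcases List.mem_cons.1 hr with rfl | hr
    · exact ⟨hb, hv⟩
    · exact h.vars r hr
  base := h.base
  size := h.size
  input := h.input
  length := h.length
  mem := h.mem

theorem runsIn_ite_flag {W m b : ℕ} {t : Test} {s : State} (hW : 1 < W) :
    ∃ v, (t.holds s → v = 1) ∧ (¬ t.holds s → v = 0) ∧
    RunsIn W m (.ite t (.instr (.natConst b 1)) (.instr (.natConst b 0))) s 2 (s.setNat b v) := by
  by_cases h : t.holds s
  · exact ⟨1, fun _ => rfl, fun h' => absurd h h', .ite_true h (.natConst hW)⟩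
  · exact ⟨0, fun h' => absurd h' h, fun _ => rfl, .ite_false h (.natConst (by omega))⟩

/-- The cost of sequential composition with `k` extra instructions: factors add up and the larger
degree prevails. -/
theorem add_mul_pow_le {n : ℕ} (hn : 0 < n) (c₁ c₂ d₁ d₂ k : ℕ) :
    c₁ * n ^ d₁ + (c₂ * n ^ d₂ + k) ≤ (c₁ + c₂ + k) * n ^ max d₁ d₂ := by
  have h₁ : n ^ d₁ ≤ n ^ max d₁ d₂ := Nat.pow_le_pow_right hn (le_max_left _ _)
  have h₂ : n ^ d₂ ≤ n ^ max d₁ d₂ := Nat.pow_le_pow_right hn (le_max_right _ _)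
  have h₃ : 1 ≤ n ^ max d₁ d₂ := Nat.one_le_pow _ _ hn
  nlinarith [Nat.mul_le_mul_left c₁ h₁, Nat.mul_le_mul_left c₂ h₂, Nat.mul_le_mul_left k h₃]

/-- Induction on the expression. The second operand is computed with scratch registers from `b + 1`
on, so the first value survives in `b`. For a sum, the loop invariant is that the accumulator holds
the partial sum; partial sums stay below `W` because the bound for the whole sum does. -/
theorem Expr.runsIn_compile {W m n : ℕ} {l : List ℝ} (hn : 1 < n) (hW : n < W) (e : Expr)
    {V : List ℕ} {b : ℕ} {s : State} (hok : e.Ok W m n V b) (hs : Ready n l V b s) :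
    ∃ s', RunsIn W m (e.compile b) s (e.coef * n ^ e.deg) s' ∧
      s'.natReg b = e.eval n l s.natReg s.natMem ∧ SameBelow b s s' := by
  have pair : ∀ (e₁ e₂ : Expr) {V : List ℕ} {b : ℕ} {s : State}, Ok W m n V b e₁ →
      Ok W m n V (b + 1) e₂ → Ready n l V b s →
      (∀ {V : List ℕ} {b : ℕ} {s : State}, e₁.Ok W m n V b → Ready n l V b s →
        ∃ s', RunsIn W m (e₁.compile b) s (e₁.coef * n ^ e₁.deg) s' ∧
          s'.natReg b = e₁.eval n l s.natReg s.natMem ∧ SameBelow b s s') →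
      (∀ {V : List ℕ} {b : ℕ} {s : State}, e₂.Ok W m n V b → Ready n l V b s →
        ∃ s', RunsIn W m (e₂.compile b) s (e₂.coef * n ^ e₂.deg) s' ∧
          s'.natReg b = e₂.eval n l s.natReg s.natMem ∧ SameBelow b s s') →
      ∃ s₁ s₂, RunsIn W m (e₁.compile b) s (e₁.coef * n ^ e₁.deg) s₁ ∧
        RunsIn W m (e₂.compile (b + 1)) s₁ (e₂.coef * n ^ e₂.deg) s₂ ∧
        s₂.natReg b = e₁.eval n l s.natReg s.natMem ∧
        s₂.natReg (b + 1) = e₂.eval n l s.natReg s.natMem ∧ SameBelow b s s₂ := by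
    intro e₁ e₂ V b s ho₁ ho₂ hs ih₁ ih₂
    obtain ⟨s₁, hr₁, hv₁, hb₁⟩ := ih₁ ho₁ hs
    obtain ⟨s₂, hr₂, hv₂, hb₂⟩ := ih₂ ho₂ ((hs.same hb₁).mono (Nat.le_succ b))
    refine ⟨s₁, s₂, hr₁, hr₂, ?_, ?_, hb₁.trans (hb₂.mono (Nat.le_succ b))⟩
    · rw [hb₂.reg b (by omega), hv₁]
    · rw [hv₂, hb₁.mem]
      exact eval_congr e₂ ho₂ fun r hr => hb₁.reg r (hs.vars r hr).1
  have time := add_mul_pow_le (show 0 < n by omega)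
  induction e generalizing V b s with
  | const k =>
    exact ⟨_, (RunsIn.natConst hok).mono (by simp [coef, deg]), by simp [eval],
      SameBelow.rfl.setNat le_rfl⟩
  | size =>
    have hb := hs.base
    have h0 := hs.size
    refine ⟨_, ((RunsIn.natConst (by omega)).seq (RunsIn.natAdd ?_)).mono (by simp [coef, deg]),
      ?_, (SameBelow.rfl.setNat le_rfl).setNat le_rfl⟩
    · simp [Function.update_of_ne hb.ne, h0, hW]
    · simp [Function.update_of_ne hb.ne, h0, eval]
  | var r =>
    obtain ⟨hrb, hrn⟩ := hs.vars r hok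
    refine ⟨_, ((RunsIn.natConst (by omega)).seq (RunsIn.natAdd ?_)).mono (by simp [coef, deg]),
      ?_, (SameBelow.rfl.setNat le_rfl).setNat le_rfl⟩
    · simp [Function.update_of_ne hrb.ne]; omega
    · simp [Function.update_of_ne hrb.ne, eval]
  | op o e₁ e₂ ih₁ ih₂ =>
    obtain ⟨s₁, s₂, hr₁, hr₂, hv₁, hv₂, hb⟩ := pair e₁ e₂ hok.2.2.1 hok.2.2.2 hs ih₁ ih₂
    have hle := eval_le_bound (op o e₁ e₂) (l := l) hok (fun r hr => (hs.vars r hr).2) hs.mem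
    have hsome : o.evalNat (e₁.eval n l s.natReg s.natMem) (e₂.eval n l s.natReg s.natMem) =
        some (eval n l (op o e₁ e₂) s.natReg s.natMem) := by
      cases o with
      | div => exact absurd rfl hok.1
      | _ => rfl
    refine ⟨_, (hr₁.seq (hr₂.seq (RunsIn.natArith (v := _) (by rw [hv₁, hv₂]; exact hsome)
      (hle.trans_lt hok.2.1)))).mono (time _ _ _ _ _), by simp, hb.setNat le_rfl⟩
  | load e ih =>
    obtain ⟨s₁, hr, hv, hb⟩ := ih hok.2 hs
    have hle := (eval_le_bound e (l := l) hok.2 (fun r hr => (hs.vars r hr).2) hs.mem).trans_lt hok.1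
    refine ⟨s₁.setNat b (s₁.natMem (s₁.natReg b)),
      (hr.seq (RunsIn.instr ?_)).mono ?_, ?_, hb.setNat le_rfl⟩
    · simp [Instr.step, hv, hle]
    · simp only [coef, deg]
      nlinarith [Nat.one_le_pow e.deg n (by omega)]
    · simp [hv, eval, hb.mem]
  | lt e₁ e₂ ih₁ ih₂ =>
    obtain ⟨s₁, s₂, hr₁, hr₂, hv₁, hv₂, hb⟩ := pair e₁ e₂ hok.1 hok.2 hs ih₁ ih₂
    obtain ⟨v, ht, hf, hr⟩ := runsIn_ite_flag (m := m) (b := b) (t := .natLt b (b + 1)) (s := s₂)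
      (hn.trans hW)
    refine ⟨_, (hr₁.seq (hr₂.seq hr)).mono (time _ _ _ _ _), ?_, hb.setNat le_rfl⟩
    simp only [Test.holds, hv₁, hv₂] at ht hf
    simp only [State.natReg_setNat, Function.update_self, eval]
    split <;> tauto
  | eq e₁ e₂ ih₁ ih₂ =>
    obtain ⟨s₁, s₂, hr₁, hr₂, hv₁, hv₂, hb⟩ := pair e₁ e₂ hok.1 hok.2 hs ih₁ ih₂
    obtain ⟨v, ht, hf, hr⟩ := runsIn_ite_flag (m := m) (b := b) (t := .natEq b (b + 1)) (s := s₂)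
      (hn.trans hW)
    refine ⟨_, (hr₁.seq (hr₂.seq hr)).mono (time _ _ _ _ _), ?_, hb.setNat le_rfl⟩
    simp only [Test.holds, hv₁, hv₂] at ht hf
    simp only [State.natReg_setNat, Function.update_self, eval]
    split <;> tauto
  | cmp z e₁ e₂ ih₁ ih₂ =>
    obtain ⟨s₁, s₂, hr₁, hr₂, hv₁, hv₂, hb⟩ := pair e₁ e₂ hok.2.2.1 hok.2.2.2 hs ih₁ ih₂
    have hl₁ := (eval_le_bound e₁ (l := l) hok.2.2.1 (fun r hr => (hs.vars r hr).2) hs.mem).trans_lt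
      hok.1
    have hl₂ := (eval_le_bound e₂ (l := l) hok.2.2.2 (fun r hr => (hs.vars r hr).2) hs.mem).trans_lt
      hok.2.1
    rw [← hs.length] at hl₁ hl₂
    have hin : s₂.input = l := hb.input.trans hs.input
    set x₁ := l.getD (e₁.eval n l s.natReg s.natMem) 0 with hx₁
    set x₂ := l.getD (e₂.eval n l s.natReg s.natMem) 0 with hx₂
    rw [List.getD_eq_getElem _ _ hl₁] at hx₁
    rw [List.getD_eq_getElem _ _ hl₂] at hx₂
    have hi₁ : (Instr.readInput 0 b).step W m s₂ = some (s₂.setReal 0 x₁) := by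
      simp [Instr.step, hin, hv₁, hx₁, hl₁]
    have hi₂ : (Instr.readInput 1 (b + 1)).step W m (s₂.setReal 0 x₁) =
        some ((s₂.setReal 0 x₁).setReal 1 x₂) := by
      simp [Instr.step, hin, hv₂, hx₂, hl₂]
    have hi₃ : (Instr.realConst 2 z).step W m ((s₂.setReal 0 x₁).setReal 1 x₂) =
        some (((s₂.setReal 0 x₁).setReal 1 x₂).setReal 2 z) := by
      simp [Instr.step]
    have hi₄ : (Instr.realArith .add 1 1 2).step W m (((s₂.setReal 0 x₁).setReal 1 x₂).setReal 2 z) =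
        some ((((s₂.setReal 0 x₁).setReal 1 x₂).setReal 2 z).setReal 1 (x₂ + z)) := by
      simp [Instr.step, ArithOp.evalReal]
    obtain ⟨v, ht, hf, hr⟩ := runsIn_ite_flag (m := m) (b := b) (t := .realLt 0 1)
      (s := (((s₂.setReal 0 x₁).setReal 1 x₂).setReal 2 z).setReal 1 (x₂ + z)) (hn.trans hW)
    refine ⟨_, (hr₁.seq (hr₂.seq ((RunsIn.instr hi₁).seq ((RunsIn.instr hi₂).seq
      ((RunsIn.instr hi₃).seq ((RunsIn.instr hi₄).seq hr)))))).mono (time _ _ _ _ _), ?_,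
      hb.setReal.setReal.setReal.setReal.setNat le_rfl⟩
    simp [Test.holds] at ht hf
    simp only [State.natReg_setNat, Function.update_self, eval]
    split
    · exact ht ‹_›
    · exact hf (not_lt.1 ‹_›)
  | sum v e ih =>
    obtain ⟨hbv, hbd, hok⟩ := hok
    have hb := hs.base
    set f : ℕ → ℕ := fun k => e.eval n l (Function.update s.natReg v k) s.natMem with hf
    have hfb : ∀ k < n, f k ≤ e.bound n := fun k hk =>
      eval_le_bound e hok (fun r hr => by
        by_cases hrv : r = v
        · simpa [hrv] using hk
        · simp only [Function.update_of_ne hrv]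
          exact (hs.vars r ((List.mem_cons.1 hr).resolve_left hrv)).2) hs.mem
    have hsum : ∀ k ≤ n, ∑ i ∈ Finset.range k, f i < W := fun k hk => by
      refine lt_of_le_of_lt ?_ hbd
      refine (Finset.sum_le_card_nsmul _ _ (e.bound n) fun i hi => hfb i ?_).trans ?_
      · exact (Finset.mem_range.1 hi).trans_le hk
      · simpa using Nat.mul_le_mul_right _ hk
    let Inv : ℕ → State → Prop := fun k s' =>
      s'.natReg v = k ∧ s'.natReg (v + 1) = ∑ i ∈ Finset.range k, f i ∧ SameBelow v s s'
    have hInv0 : Inv 0 ((s.setNat v 0).setNat (v + 1) 0) :=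
      ⟨by simp, by simp, (SameBelow.rfl.setNat le_rfl).setNat (Nat.le_succ v)⟩
    obtain ⟨s₁, hr₁, hv₁, ha₁, hb₁⟩ := RunsIn.count (W := W) (m := m) (v := v) (n := n)
      (T := e.coef * n ^ e.deg + (1 + (1 + 1)))
      (p := .seq (e.compile (v + 2)) (.seq (.instr (.natArith .add (v + 1) (v + 1) (v + 2)))
        (.seq (.instr (.natConst (v + 2) 1)) (.instr (.natArith .add v v (v + 2)))))) Inv
      (fun k s' h => ⟨h.1, by rw [h.2.2.reg 0 (by omega), hs.size]⟩)
      (by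
        rintro k hk s' ⟨hv, ha, hsb⟩
        have hready : Ready n l (v :: V) (v + 2) s' :=
          (((hs.mono hbv).same hsb).mono (by omega)).cons (by omega) (by omega)
        obtain ⟨s₂, hr₂, hv₂, hb₂⟩ := ih hok hready
        have hval : s₂.natReg (v + 2) = f k := by
          rw [hv₂, hf, hsb.mem]
          refine eval_congr e hok fun r hr => ?_
          by_cases hrv : r = v
          · simp [hrv, hv]
          · rw [Function.update_of_ne hrv]
            exact hsb.reg r ((hs.vars r ((List.mem_cons.1 hr).resolve_left hrv)).1.trans_le hbv)
        have hva : s₂.natReg (v + 1) = ∑ i ∈ Finset.range k, f i := by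
          rw [hb₂.reg _ (by omega), ha]
        have hvv : s₂.natReg v = k := by rw [hb₂.reg _ (by omega), hv]
        have hs1 := hsum (k + 1) (by omega)
        rw [Finset.sum_range_succ] at hs1
        refine ⟨_, hr₂.seq ((RunsIn.natAdd (by rw [hva, hval]; exact hs1)).seq
          ((RunsIn.natConst (by omega)).seq (RunsIn.natAdd ?_))), ?_, ?_, ?_⟩
        · simp [hvv]; omega
        · simp [hvv]
        · simp [hva, hval, Finset.sum_range_succ]
        · exact (((hsb.trans (hb₂.mono (by omega))).setNat (by omega)).setNat (by omega)).setNat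
            le_rfl) hInv0
    refine ⟨_, ((RunsIn.natConst (by omega)).seq ((RunsIn.natConst (by omega)).seq
      (hr₁.seq ((RunsIn.natConst (by omega)).seq (RunsIn.natAdd ?_))))).mono ?_, ?_,
      ((hb₁.mono hbv).setNat le_rfl).setNat le_rfl⟩
    · have hne : v + 1 ≠ b := by omega
      simpa [Function.update_of_ne hne, ha₁] using hsum n le_rfl
    · simp only [coef, deg, pow_succ]
      have h1 := Nat.one_le_pow e.deg n (by omega)
      nlinarith [Nat.mul_le_mul_right n h1]
    · have hne : v + 1 ≠ b := by omega
      simp [Function.update_of_ne hne, ha₁, eval, hf]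

end RealRAM

namespace RealRAM

/-! ### Statements -/

/-- Statements over expressions; `loop v s` runs `s` for all `v < size`. -/
inductive Stmt
  | store (a e : Expr)
  | out (a e : Expr)
  | seq (s₁ s₂ : Stmt)
  /-- Run `s` if `e` is positive. -/
  | cond (e : Expr) (s : Stmt)
  | loop (v : ℕ) (s : Stmt)

namespace Stmt

/-- The effect of a statement on the memory and the output, for given values of the variables. -/
noncomputable def exec (n : ℕ) (l : List ℝ) : Stmt → (ℕ → ℕ) → (ℕ → ℕ) × (ℕ → ℕ) → (ℕ → ℕ) × (ℕ → ℕ)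
  | store a e, ρ, σ => (Function.update σ.1 (a.eval n l ρ σ.1) (e.eval n l ρ σ.1), σ.2)
  | out a e, ρ, σ => (σ.1, Function.update σ.2 (a.eval n l ρ σ.1) (e.eval n l ρ σ.1))
  | seq s₁ s₂, ρ, σ => s₂.exec n l ρ (s₁.exec n l ρ σ)
  | cond e s, ρ, σ => if 0 < e.eval n l ρ σ.1 then s.exec n l ρ σ else σ
  | loop v s, ρ, σ => Nat.rec σ (fun k τ => s.exec n l (Function.update ρ v k) τ) n

/-- The statement `s` with free variables among `V` can be run with the scratch registers from `b`
on, word limit `W` and memory limit `m`. -/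
def Ok (W m n : ℕ) : List ℕ → ℕ → Stmt → Prop
  -- Stored values must stay below `n`, because `bound` assumes this of every loaded value.
  | V, b, store a e => a.bound n < m ∧ e.bound n < n ∧ a.Ok W m n V b ∧ e.Ok W m n V (b + 1)
  | V, b, out a e => a.Ok W m n V b ∧ e.Ok W m n V (b + 1)
  | V, b, seq s₁ s₂ => Ok W m n V b s₁ ∧ Ok W m n V b s₂
  | V, b, cond e s => e.Ok W m n V b ∧ Ok W m n V b s
  | V, b, loop v s => b ≤ v ∧ Ok W m n (v :: V) (v + 1) s

/-- The program for a statement, with scratch registers from `b` on. -/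
def compile : Stmt → ℕ → Program
  | store a e, b => .seq (a.compile b) (.seq (e.compile (b + 1)) (.instr (.natStore b (b + 1))))
  | out a e, b => .seq (a.compile b) (.seq (e.compile (b + 1)) (.instr (.writeOutput b (b + 1))))
  | seq s₁ s₂, b => .seq (s₁.compile b) (s₂.compile b)
  | cond e s, b => .seq (e.compile b) (.seq (.instr (.natConst (b + 1) 0))
      (.ite (.natLt (b + 1) b) (s.compile b) .skip))
  | loop v s, _ => .seq (.instr (.natConst v 0)) (.loop (.natLt v 0) (.seq (s.compile (v + 1))
      (.seq (.instr (.natConst (v + 1) 1)) (.instr (.natArith .add v v (v + 1))))))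

/-- The degree of the running time. -/
def deg : Stmt → ℕ
  | store a e => max a.deg e.deg
  | out a e => max a.deg e.deg
  | seq s₁ s₂ => max s₁.deg s₂.deg
  | cond e s => max e.deg s.deg
  | loop _ s => s.deg + 1

/-- The constant factor of the running time. -/
def coef : Stmt → ℕ
  | store a e => a.coef + e.coef + 1
  | out a e => a.coef + e.coef + 1
  | seq s₁ s₂ => s₁.coef + s₂.coef
  | cond e s => e.coef + s.coef + 2
  | loop _ s => s.coef + 5

/-- `s'` is `s` with memory and output `σ`, except perhaps for the real registers and the
natural-number registers from `b` on. -/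
structure Result (b : ℕ) (s s' : State) (σ : (ℕ → ℕ) × (ℕ → ℕ)) : Prop where
  reg : ∀ r < b, s'.natReg r = s.natReg r
  mem : s'.natMem = σ.1
  output : s'.output = σ.2
  input : s'.input = s.input

variable {W m n : ℕ} {l : List ℝ}

theorem runsIn_cond_pos (hn : 1 < n) (hW : n < W) {e : Expr} {s : Stmt} {V : List ℕ} {b : ℕ}
    {c : State} (he : e.Ok W m n V b) (hc : Ready n l V b c)
    (hpos : 0 < e.eval n l c.natReg c.natMem) {σ : (ℕ → ℕ) × (ℕ → ℕ)} {T : ℕ}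
    (hs : ∀ c₁, SameBelow b c c₁ → ∃ c', RunsIn W m (s.compile b) c₁ T c' ∧ Result b c₁ c' σ) :
    ∃ c', RunsIn W m ((cond e s).compile b) c (e.coef * n ^ e.deg + (T + 2)) c' ∧
      Result b c c' σ := by
  obtain ⟨c₁, hr₁, hv₁, hb₁⟩ := e.runsIn_compile hn hW he hc
  have hb₂ := hb₁.setNat (d := b + 1) (v := 0) (Nat.le_succ b)
  obtain ⟨c₂, hr₂, h₂⟩ := hs _ hb₂
  refine ⟨c₂, (hr₁.seq ((RunsIn.natConst (by omega)).seq (RunsIn.ite_true ?_ hr₂))).mono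
    (by omega), ⟨fun r hr => ?_, h₂.mem, h₂.output, h₂.input.trans hb₂.input⟩⟩
  · simpa [Test.holds, hv₁] using hpos
  · rw [h₂.reg r hr, hb₂.reg r hr]

/-- Nothing is required of the skipped statement `s`; it may even exceed the memory limit. This is
what permits a run with no working memory at all. -/
theorem runsIn_cond_zero (hn : 1 < n) (hW : n < W) {e : Expr} {s : Stmt} {V : List ℕ} {b : ℕ}
    {c : State} (he : e.Ok W m n V b) (hc : Ready n l V b c)
    (hzero : ¬ 0 < e.eval n l c.natReg c.natMem) :
    ∃ c', RunsIn W m ((cond e s).compile b) c (e.coef * n ^ e.deg + 2) c' ∧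
      Result b c c' (c.natMem, c.output) := by
  obtain ⟨c₁, hr₁, hv₁, hb₁⟩ := e.runsIn_compile hn hW he hc
  have hb₂ := hb₁.setNat (d := b + 1) (v := 0) (Nat.le_succ b)
  refine ⟨_, (hr₁.seq ((RunsIn.natConst (by omega)).seq (RunsIn.ite_false ?_
    ⟨0, le_rfl, .skip _⟩))).mono (by omega), ⟨hb₂.reg, hb₂.mem, hb₂.output, hb₂.input⟩⟩
  simpa [Test.holds, hv₁] using hzero

/-- Induction on the statement. `Ready` is part of the conclusion so that the bound on the memory
contents carries over to the next statement or iteration. -/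
theorem runsIn_compile (hn : 1 < n) (hW : n < W) (s : Stmt) {V : List ℕ} {b : ℕ} {c : State}
    {ρ : ℕ → ℕ} (hok : s.Ok W m n V b) (hc : Ready n l V b c) (hρ : ∀ r ∈ V, ρ r = c.natReg r) :
    ∃ c', RunsIn W m (s.compile b) c (s.coef * n ^ s.deg) c' ∧
      Result b c c' (s.exec n l ρ (c.natMem, c.output)) ∧ Ready n l V b c' := by
  have hn0 : 0 < n := by omega
  have pair : ∀ (e₁ e₂ : Expr) {V : List ℕ} {b : ℕ} {c : State} {ρ : ℕ → ℕ}, e₁.Ok W m n V b →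
      e₂.Ok W m n V (b + 1) → Ready n l V b c → (∀ r ∈ V, ρ r = c.natReg r) →
      ∃ c₁ c₂, RunsIn W m (e₁.compile b) c (e₁.coef * n ^ e₁.deg) c₁ ∧
        RunsIn W m (e₂.compile (b + 1)) c₁ (e₂.coef * n ^ e₂.deg) c₂ ∧
        c₂.natReg b = e₁.eval n l ρ c.natMem ∧
        c₂.natReg (b + 1) = e₂.eval n l ρ c.natMem ∧ SameBelow b c c₂ := by
    intro e₁ e₂ V b c ρ ho₁ ho₂ hc hρ
    obtain ⟨c₁, hr₁, hv₁, hb₁⟩ := e₁.runsIn_compile hn hW ho₁ hc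
    obtain ⟨c₂, hr₂, hv₂, hb₂⟩ := e₂.runsIn_compile hn hW ho₂ ((hc.same hb₁).mono (Nat.le_succ b))
    refine ⟨c₁, c₂, hr₁, hr₂, ?_, ?_, hb₁.trans (hb₂.mono (Nat.le_succ b))⟩
    · rw [hb₂.reg b (by omega), hv₁]
      exact (e₁.eval_congr ho₁ hρ).symm
    · rw [hv₂, hb₁.mem]
      refine e₂.eval_congr ho₂ fun r hr => ?_
      rw [hρ r hr]
      exact hb₁.reg r (hc.vars r hr).1
  induction s generalizing V b c ρ with
  | store a e =>
    obtain ⟨ha, he, hao, heo⟩ := hok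
    obtain ⟨c₁, c₂, hr₁, hr₂, hv₁, hv₂, hb⟩ := pair a e hao heo hc hρ
    have hρn : ∀ r ∈ V, ρ r < n := fun r hr => by rw [hρ r hr]; exact (hc.vars r hr).2
    have hle := (a.eval_le_bound (l := l) hao hρn hc.mem).trans_lt ha
    have hlv := (e.eval_le_bound (l := l) heo hρn hc.mem).trans_lt he
    let μ := Function.update c₂.natMem (c₂.natReg b) (c₂.natReg (b + 1))
    refine ⟨_, (hr₁.seq (hr₂.seq (RunsIn.instr (s₂ := { c₂ with natMem := μ }) ?_))).mono (add_mul_pow_le hn0 _ _ _ _ _),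
      ⟨hb.reg, ?_, hb.output, hb.input⟩, ?_⟩
    · simp [Instr.step, hv₁, hle, μ]
    · simp [hv₁, hv₂, hb.mem, exec, μ]
    · have hr := hc.same hb
      refine ⟨hr.vars, hr.base, hr.size, hr.input, hr.length, fun x => ?_⟩
      by_cases hx : x = c₂.natReg b
      · simp [hx, hv₂, hlv, μ]
      · simpa [μ, Function.update_of_ne hx] using hr.mem x
  | out a e =>
    obtain ⟨hao, heo⟩ := hok
    obtain ⟨c₁, c₂, hr₁, hr₂, hv₁, hv₂, hb⟩ := pair a e hao heo hc hρ
    let o := Function.update c₂.output (c₂.natReg b) (c₂.natReg (b + 1))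
    refine ⟨_, (hr₁.seq (hr₂.seq (RunsIn.instr (s₂ := { c₂ with output := o }) ?_))).mono (add_mul_pow_le hn0 _ _ _ _ _),
      ⟨hb.reg, hb.mem, ?_, hb.input⟩, ?_⟩
    · simp [Instr.step, o]
    · simp [hv₁, hv₂, hb.output, exec, o]
    · have hr := hc.same hb
      exact ⟨hr.vars, hr.base, hr.size, hr.input, hr.length, hr.mem⟩
  | seq s₁ s₂ ih₁ ih₂ =>
    obtain ⟨c₁, hr₁, h₁, hc₁⟩ := ih₁ hok.1 hc hρ
    obtain ⟨c₂, hr₂, h₂, hc₂⟩ := ih₂ hok.2 hc₁ (ρ := ρ) fun r hr => by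
      rw [hρ r hr, h₁.reg r (hc.vars r hr).1]
    refine ⟨c₂, (hr₁.seq hr₂).mono ?_, ⟨fun r hr => by rw [h₂.reg r hr, h₁.reg r hr], ?_, ?_,
      h₂.input.trans h₁.input⟩, hc₂⟩
    · simpa [coef, deg] using add_mul_pow_le hn0 s₁.coef s₂.coef s₁.deg s₂.deg 0
    · rw [h₂.mem, h₁.mem, h₁.output, exec]
    · rw [h₂.output, h₁.mem, h₁.output, exec]
  | cond e s ih =>
    obtain ⟨heo, hso⟩ := hok
    have hev : e.eval n l ρ c.natMem = e.eval n l c.natReg c.natMem := e.eval_congr heo hρ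
    have ready : ∀ c', Result b c c' ((cond e s).exec n l ρ (c.natMem, c.output)) →
        (∀ a, c'.natMem a < n) → Ready n l V b c' := fun c' h hm =>
      ⟨fun r hr => ⟨(hc.vars r hr).1, by rw [h.reg r (hc.vars r hr).1]; exact (hc.vars r hr).2⟩,
        hc.base, by rw [h.reg 0 hc.base, hc.size], h.input.trans hc.input, hc.length, hm⟩
    by_cases hpos : 0 < e.eval n l ρ c.natMem
    · have hex : (cond e s).exec n l ρ (c.natMem, c.output) = s.exec n l ρ (c.natMem, c.output) :=
        if_pos hpos
      -- The final memory is determined by `exec`, so its bound can be read off from a run of `s`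
      -- that starts directly in `c`.
      have hmem : ∀ a, (s.exec n l ρ (c.natMem, c.output)).1 a < n := by
        obtain ⟨c₂, -, h₂, hc₂⟩ := ih hso hc hρ
        rw [← h₂.mem]; exact hc₂.mem
      obtain ⟨c₂, hr, h⟩ := runsIn_cond_pos hn hW (s := s) heo hc (hev ▸ hpos)
        (σ := s.exec n l ρ (c.natMem, c.output)) (T := s.coef * n ^ s.deg) (fun c₁ hb => by
          obtain ⟨c₂, hr₂, h₂, hc₂⟩ := ih hso (hc.same hb) (ρ := ρ) fun r hr => by
            rw [hρ r hr, hb.reg r (hc.vars r hr).1]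
          rw [hb.mem, hb.output] at h₂
          exact ⟨c₂, hr₂, h₂⟩)
      refine ⟨c₂, hr.mono (add_mul_pow_le hn0 _ _ _ _ _), hex ▸ h, ready c₂ (hex ▸ h) ?_⟩
      rw [h.mem]; exact hmem
    · have hex : (cond e s).exec n l ρ (c.natMem, c.output) = (c.natMem, c.output) := if_neg hpos
      obtain ⟨c₂, hr, h⟩ := runsIn_cond_zero hn hW (s := s) heo hc (hev ▸ hpos)
      rw [← hex] at h
      refine ⟨c₂, hr.mono ?_, h, ready c₂ h ?_⟩
      · exact le_trans (by omega) (add_mul_pow_le hn0 _ s.coef _ s.deg _)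
      · rw [h.mem, hex]; exact hc.mem
  | loop v s ih =>
    obtain ⟨hbv, hok⟩ := hok
    set g : ℕ → (ℕ → ℕ) × (ℕ → ℕ) := fun k =>
      Nat.rec (c.natMem, c.output) (fun k τ => s.exec n l (Function.update ρ v k) τ) k with hg
    let Inv : ℕ → State → Prop := fun k c' =>
      c'.natReg v = k ∧ Result v c c' (g k) ∧ ∀ a, c'.natMem a < n
    have hb := hc.base
    have ready : ∀ c' k, Result v c c' (g k) → (∀ a, c'.natMem a < n) → Ready n l V v c' :=
      fun c' k h hm =>
      ⟨fun r hr => ⟨(hc.vars r hr).1.trans_le hbv, by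
        rw [h.reg r ((hc.vars r hr).1.trans_le hbv)]; exact (hc.vars r hr).2⟩,
        by omega, by rw [h.reg 0 (by omega), hc.size], h.input.trans hc.input, hc.length, hm⟩
    obtain ⟨c₁, hr₁, hv₁, h₁, hm₁⟩ := RunsIn.count (W := W) (m := m) (v := v) (n := n)
      (T := s.coef * n ^ s.deg + (1 + 1)) (s := c.setNat v 0)
      (p := .seq (s.compile (v + 1)) (.seq (.instr (.natConst (v + 1) 1))
        (.instr (.natArith .add v v (v + 1))))) Inv
      (fun k c' h => ⟨h.1, by rw [h.2.1.reg 0 (by omega), hc.size]⟩)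
      (by
        rintro k hk c' ⟨hv, hres, hm⟩
        have hready : Ready n l (v :: V) (v + 1) c' :=
          ((ready c' k hres hm).mono (Nat.le_succ v)).cons (by omega) (by omega)
        obtain ⟨c₂, hr₂, h₂, hc₂⟩ := ih hok hready (ρ := Function.update ρ v k) fun r hr => by
          by_cases hrv : r = v
          · simp [hrv, hv]
          · have hr := (List.mem_cons.1 hr).resolve_left hrv
            rw [Function.update_of_ne hrv, hρ r hr, hres.reg r ((hc.vars r hr).1.trans_le hbv)]
        have hvv : c₂.natReg v = k := by rw [h₂.reg _ (by omega), hv]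
        refine ⟨_, hr₂.seq ((RunsIn.natConst (by omega)).seq (RunsIn.natAdd ?_)), ?_,
          ⟨fun r hr => ?_, ?_, ?_, ?_⟩, ?_⟩
        · simp [hvv]; omega
        · simp [hvv]
        · have h1 : r ≠ v := by omega
          have h2 : r ≠ v + 1 := by omega
          simp [Function.update_of_ne h1, Function.update_of_ne h2, h₂.reg r (by omega),
            hres.reg r hr]
        · simp [h₂.mem, hres.mem, hres.output, hg]
        · simp [h₂.output, hres.mem, hres.output, hg]
        · simp [h₂.input, hres.input]
        · simpa using hc₂.mem)
      ⟨by simp, ⟨fun r hr => by simp [Function.update_of_ne hr.ne], by simp [hg], by simp [hg],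
        by simp⟩, by simpa using hc.mem⟩
    refine ⟨c₁, ((RunsIn.natConst (by omega)).seq hr₁).mono ?_,
      ⟨fun r hr => h₁.reg r (hr.trans_le hbv), h₁.mem, h₁.output, h₁.input⟩, ?_⟩
    · simp only [coef, deg, pow_succ]
      have h1 := Nat.one_le_pow s.deg n (by omega)
      nlinarith [Nat.mul_le_mul_right n h1]
    · have hr := ready c₁ n h₁ hm₁
      exact ⟨fun r hr' => ⟨(hc.vars r hr').1, (hr.vars r hr').2⟩, hb, hr.size, hr.input, hr.length,
        hr.mem⟩

end Stmt
end RealRAM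

namespace MixedLabeling

/-! ### The combinatorics of labelings -/

section Combinatorics

variable {n : ℕ} {X Y : ℕ → ℝ}

/-- The leader of `j` intersects the label of `i`. -/
def Force (X Y : ℕ → ℝ) (i j : ℕ) : Prop := Y i < Y j ∧ Y j ≤ Y i + 1 ∧ X i ≤ X j

/-- The labels of `i` and `j` intersect. -/
def Conf (X Y : ℕ → ℝ) (i j : ℕ) : Prop :=
  i ≠ j ∧ X i ≤ X j + 1 ∧ X j ≤ X i + 1 ∧ Y i ≤ Y j + 1 ∧ Y j ≤ Y i + 1

theorem Conf.symm {i j : ℕ} (h : Conf X Y i j) : Conf X Y j i :=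
  ⟨h.1.symm, h.2.2.1, h.2.1, h.2.2.2.2, h.2.2.2.1⟩

/-- `I` is the set of internally labeled points of a labeling. -/
structure Valid (n : ℕ) (X Y : ℕ → ℝ) (I : Finset ℕ) : Prop where
  lt : ∀ i ∈ I, i < n
  closed : ∀ i ∈ I, ∀ j < n, Force X Y i j → j ∈ I
  free : ∀ i ∈ I, ∀ j ∈ I, ¬ Conf X Y i j

/-- If `i` is labeled internally, then so is `j`. -/
def Reach (n : ℕ) (X Y : ℕ → ℝ) : ℕ → ℕ → Prop :=
  Relation.ReflTransGen fun i j => j < n ∧ Force X Y i j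

theorem Reach.lt {i j : ℕ} (h : Reach n X Y i j) (hi : i < n) : j < n := by
  induction h with
  | refl => exact hi
  | tail _ h _ => exact h.1

theorem Reach.le {i j : ℕ} (h : Reach n X Y i j) : Y i ≤ Y j := by
  induction h with
  | refl => exact le_rfl
  | tail _ h ih => exact ih.trans h.2.1.le

theorem Valid.reach {I : Finset ℕ} (hI : Valid n X Y I) {i j : ℕ} (hi : i ∈ I)
    (h : Reach n X Y i j) : j ∈ I := by
  induction h with
  | refl => exact hi
  | tail _ h ih => exact hI.closed _ ih _ h.1 h.2

theorem valid_empty : Valid n X Y ∅ := ⟨by simp, by simp, by simp⟩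

/-- Forcing goes upward, so cutting off the lower part of a valid set preserves closedness. -/
theorem Valid.filter_le {I : Finset ℕ} (hI : Valid n X Y I) (a : ℝ) :
    Valid n X Y (I.filter fun p => a ≤ Y p) where
  lt i hi := hI.lt i (Finset.mem_filter.1 hi).1
  closed i hi j hj h := Finset.mem_filter.2 ⟨hI.closed i (Finset.mem_filter.1 hi).1 j hj h,
    (Finset.mem_filter.1 hi).2.trans h.1.le⟩
  free i hi j hj := hI.free i (Finset.mem_filter.1 hi).1 j (Finset.mem_filter.1 hj).1

/-- Follow the chain from `m` to the step from `a` to `u` that passes the height of `m'`. As `Y u ≤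
Y a + 1`, the point `m'` is within vertical range of `a`, and `u` within that of `m'`. If `m'` is
not to the left of `a`, then `a` forces `m'`, which is excluded; otherwise `m'` is to the left of
`u` and forces it. -/
theorem Reach.of_not_reach (hY : ∀ i < n, ∀ j < n, Y i = Y j → i = j) {m m' q : ℕ}
    (hm' : m' < n) (h : Reach n X Y m q) (hlt : Y m < Y m') (hq : Y m' < Y q)
    (hn : ¬ Reach n X Y m m') : Reach n X Y m' q := by
  induction h using Relation.ReflTransGen.head_induction_on with
  | refl => exact absurd hq hlt.not_gt
  | @head a u hau hu ih =>
    have hn' : ¬ Reach n X Y u m' := fun h => hn (.head hau h)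
    rcases lt_trichotomy (Y u) (Y m') with h | h | h
    · exact ih h hn'
    · rw [hY u hau.1 m' hm' h] at hn'
      exact absurd .refl hn'
    · by_cases hx : X a ≤ X m'
      · exact absurd (.single ⟨hm', hlt, h.le.trans hau.2.2.1, hx⟩) hn
      · exact .head ⟨hau.1, h, by linarith [hau.2.2.1], (not_le.1 hx).le.trans hau.2.2.2⟩ hu

/-- All three heights lie within one unit. Compare x-coordinates: if `b` is not left of `i`, then
`i` forces `b`; if `b` is not right of `p`, then `b` forces `p`; otherwise `b` is horizontally
between `p` and `i`, and its label meets that of `i`. -/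
theorem Conf.between {i b p : ℕ} (h : Conf X Y i p) (hib : Y i < Y b) (hbp : Y b < Y p) :
    Force X Y i b ∨ Force X Y b p ∨ Conf X Y i b := by
  obtain ⟨-, h1, h2, h3, h4⟩ := h
  rcases le_or_gt (X i) (X b) with hx | hx
  · exact .inl ⟨hib, by linarith, hx⟩
  · rcases le_or_gt (X b) (X p) with hx' | hx'
    · exact .inr (.inl ⟨hbp, by linarith, hx'⟩)
    · exact .inr (.inr ⟨fun e => by simp [e] at hib, by linarith, by linarith, by linarith,
        by linarith⟩)

/-- `S` is a largest valid set with lowest point `i`, or empty if there is no such set. -/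
structure IsBest (n : ℕ) (X Y : ℕ → ℝ) (i : ℕ) (S : Finset ℕ) : Prop where
  valid : Valid n X Y S
  low : ∀ p ∈ S, i ∈ S ∧ Y i ≤ Y p
  card_le : ∀ I, Valid n X Y I → i ∈ I → (∀ p ∈ I, Y i ≤ Y p) → I.card ≤ S.card

open Classical in
/-- The points that are labeled internally if `m` is. -/
noncomputable def reachSet (n : ℕ) (X Y : ℕ → ℝ) (m : ℕ) : Finset ℕ :=
  (Finset.range n).filter (Reach n X Y m)

theorem mem_reachSet {m p : ℕ} (hm : m < n) : p ∈ reachSet n X Y m ↔ Reach n X Y m p := by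
  simp only [reachSet, Finset.mem_filter, Finset.mem_range, and_iff_right_iff_imp]
  exact fun h => h.lt hm

/-- No label of `R` intersects a label of `R ∪ S`. -/
def Free (X Y : ℕ → ℝ) (R S : Finset ℕ) : Prop := ∀ p ∈ R ∪ S, ∀ i ∈ R, ¬ Conf X Y i p

theorem Valid.union {m : ℕ} {S : Finset ℕ} (hm : m < n) (hS : Valid n X Y S)
    (hf : Free X Y (reachSet n X Y m) S) : Valid n X Y (reachSet n X Y m ∪ S) where
  lt i hi := by
    rcases Finset.mem_union.1 hi with hi | hi
    · exact ((mem_reachSet hm).1 hi).lt hm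
    · exact hS.lt i hi
  closed i hi j hj h := by
    rcases Finset.mem_union.1 hi with hi | hi
    · exact Finset.mem_union_left _ ((mem_reachSet hm).2 (((mem_reachSet hm).1 hi).tail ⟨hj, h⟩))
    · exact Finset.mem_union_right _ (hS.closed i hi j hj h)
  free i hi j hj h := by
    rcases Finset.mem_union.1 hi with hi' | hi'
    · exact hf j hj i hi' h
    · rcases Finset.mem_union.1 hj with hj' | hj'
      · exact hf i hi j hj' h.symm
      · exact hS.free i hi' j hj' h

/-- The exchange argument behind the recursion: the part of `I` from its lowest unreached point `m'`
upward can be replaced by `S m'`. The choice `q = m` with `S m = ∅` encodes the candidate that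
consists of the reached points alone. -/
theorem exists_free_card_le (hY : ∀ i < n, ∀ j < n, Y i = Y j → i = j) {m : ℕ}
    (hm : m < n) {S : ℕ → Finset ℕ} (hS : ∀ q < n, Y m < Y q → IsBest n X Y q (S q))
    (hSm : S m = ∅) {I : Finset ℕ} (hI : Valid n X Y I) (hmI : m ∈ I)
    (hlow : ∀ p ∈ I, Y m ≤ Y p) :
    ∃ q < n, Free X Y (reachSet n X Y m) (S q) ∧ I.card ≤ (reachSet n X Y m ∪ S q).card := by
  set R := reachSet n X Y m with hR
  have hRI : ∀ p ∈ R, p ∈ I := fun p hp => hI.reach hmI ((mem_reachSet hm).1 hp)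
  have hmR : m ∈ R := (mem_reachSet hm).2 .refl
  by_cases hIR : I ⊆ R
  · refine ⟨m, hm, fun p hp i hi => ?_, ?_⟩
    · rw [hSm, Finset.union_empty] at hp
      exact hI.free i (hRI i hi) p (hRI p hp)
    · rw [hSm, Finset.union_empty]; exact Finset.card_le_card hIR
  obtain ⟨m', hm'd, hmin⟩ := (I \ R).exists_min_image Y (Finset.sdiff_nonempty.2 hIR)
  obtain ⟨hm'I, hm'R⟩ := Finset.mem_sdiff.1 hm'd
  have hm'n := hI.lt m' hm'I
  have hnr : ¬ Reach n X Y m m' := fun h => hm'R ((mem_reachSet hm).2 h)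
  have hlt : Y m < Y m' := lt_of_le_of_ne (hlow m' hm'I) fun h =>
    hm'R (hY m hm m' hm'n h ▸ hmR)
  have hB := hS m' hm'n hlt
  have hcard := hB.card_le _ (hI.filter_le (Y m')) (Finset.mem_filter.2 ⟨hm'I, le_rfl⟩)
    fun p hp => (Finset.mem_filter.1 hp).2
  have hne' : (I.filter fun p => Y m' ≤ Y p).Nonempty := ⟨m', Finset.mem_filter.2 ⟨hm'I, le_rfl⟩⟩
  have hne : (S m').Nonempty := Finset.card_pos.1 (hne'.card_pos.trans_le hcard)
  have hm'S : m' ∈ S m' := (hB.low _ hne.choose_spec).1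
  refine ⟨m', hm'n, fun p hp i hi h => ?_, ?_⟩
  · by_cases hpI : p ∈ I
    · exact hI.free i (hRI i hi) p hpI h
    have hpS : p ∈ S m' := (Finset.mem_union.1 hp).resolve_left fun h => hpI (hRI p h)
    have hpn := hB.valid.lt p hpS
    have hlt' : Y m' < Y p := lt_of_le_of_ne (hB.low p hpS).2 fun h =>
      hpI (hY m' hm'n p hpn h ▸ hm'I)
    have hri := (mem_reachSet hm).1 hi
    -- Below `m'`, every outcome of `Conf.between` is contradictory; above `m'`, the point `i` is
    -- reached from `m'` and thus lies in the conflict-free set `S m'`.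
    rcases lt_trichotomy (Y i) (Y m') with hi' | hi' | hi'
    · rcases h.between hi' hlt' with h | h | h
      · exact hnr (hri.tail ⟨hm'n, h⟩)
      · exact hpI (hI.closed m' hm'I p hpn h)
      · exact hI.free i (hRI i hi) m' hm'I h
    · exact hm'R (hY i (hI.lt i (hRI i hi)) m' hm'n hi' ▸ hi)
    · exact hB.valid.free i (hB.valid.reach hm'S (hri.of_not_reach hY hm'n hlt hi' hnr)) p hpS h
  · have hdis : Disjoint (R.filter fun p => Y p < Y m') (S m') :=
      Finset.disjoint_left.2 fun p hp hpS =>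
        ((Finset.mem_filter.1 hp).2).not_ge (hB.low p hpS).2
    -- By the choice of `m'`, every point of `I` below `m'` lies in `R`. The lower part of `R` is
    -- disjoint from `S m'`, so the cardinalities may be added.
    calc I.card ≤ ((R.filter fun p => Y p < Y m') ∪ I.filter fun p => Y m' ≤ Y p).card := by
          refine Finset.card_le_card fun p hp => Finset.mem_union.2 ?_
          rcases lt_or_ge (Y p) (Y m') with h | h
          · refine .inl (Finset.mem_filter.2 ⟨?_, h⟩)
            by_contra hpR
            exact h.not_ge (hmin p (Finset.mem_sdiff.2 ⟨hp, hpR⟩))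
          · exact .inr (Finset.mem_filter.2 ⟨hp, h⟩)
      _ ≤ (R.filter fun p => Y p < Y m').card + (S m').card :=
          (Finset.card_union_le _ _).trans (Nat.add_le_add_left hcard _)
      _ = ((R.filter fun p => Y p < Y m') ∪ S m').card := (Finset.card_union_of_disjoint hdis).symm
      _ ≤ (R ∪ S m').card :=
          Finset.card_le_card (Finset.union_subset_union_left (Finset.filter_subset _ _))

open Classical in
/-- The number of points in `R ∪ S`, or zero if there are conflicts. -/
noncomputable def score (X Y : ℕ → ℝ) (R S : Finset ℕ) : ℕ :=
  if Free X Y R S then (R ∪ S).card else 0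

/-- Since `m` lies in its own reach set, a conflict-free candidate has positive score. Maximal score
zero thus means that no valid set has lowest point `m`, and the empty set records this. Indices not
above `m` carry empty sets and merely repeat the candidate without a second part. -/
theorem isBest_of_score (hY : ∀ i < n, ∀ j < n, Y i = Y j → i = j) {m b : ℕ} (hm : m < n)
    {S : ℕ → Finset ℕ} (hS : ∀ q < n, Y m < Y q → IsBest n X Y q (S q))
    (hS' : ∀ q < n, ¬ Y m < Y q → S q = ∅) (hb : b < n)
    (hmax : ∀ q < n, score X Y (reachSet n X Y m) (S q) ≤ score X Y (reachSet n X Y m) (S b)) :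
    IsBest n X Y m (if 0 < score X Y (reachSet n X Y m) (S b) then reachSet n X Y m ∪ S b
      else ∅) := by
  have hcard : ∀ I, Valid n X Y I → m ∈ I → (∀ p ∈ I, Y m ≤ Y p) →
      I.card ≤ score X Y (reachSet n X Y m) (S b) := fun I hI hmI hlow => by
    obtain ⟨q, hq, hf, hle⟩ := exists_free_card_le hY hm hS (hS' m hm (lt_irrefl _)) hI hmI hlow
    refine le_trans ?_ (hmax q hq)
    rwa [score, if_pos hf]
  split
  · rename_i hpos
    have hf : Free X Y (reachSet n X Y m) (S b) := by
      by_contra h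
      simp [score, h] at hpos
    have hmR : m ∈ reachSet n X Y m := (mem_reachSet hm).2 .refl
    have hbest : ∀ p ∈ S b, Y m ≤ Y p := fun p hp => by
      by_cases h : Y m < Y b
      · exact h.le.trans ((hS b hb h).low p hp).2
      · simp [hS' b hb h] at hp
    have hv : Valid n X Y (S b) := by
      by_cases h : Y m < Y b
      · exact (hS b hb h).valid
      · rw [hS' b hb h]; exact valid_empty
    refine ⟨hv.union hm hf, fun p hp => ⟨Finset.mem_union_left _ hmR, ?_⟩, fun I hI hmI hlow => ?_⟩
    · rcases Finset.mem_union.1 hp with hp | hp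
      · exact ((mem_reachSet hm).1 hp).le
      · exact hbest p hp
    · simpa [score, hf] using hcard I hI hmI hlow
  · rename_i hpos
    refine ⟨valid_empty, by simp, fun I hI hmI hlow => ?_⟩
    have := hcard I hI hmI hlow
    simp only [Finset.card_empty]; omega

theorem card_le_of_isBest {S : ℕ → Finset ℕ} (hS : ∀ q < n, IsBest n X Y q (S q)) {b : ℕ}
    (hmax : ∀ q < n, (S q).card ≤ (S b).card) {I : Finset ℕ} (hI : Valid n X Y I) :
    I.card ≤ (S b).card := by
  rcases I.eq_empty_or_nonempty with rfl | hne
  · simp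
  · obtain ⟨i, hi, hmin⟩ := I.exists_min_image Y hne
    have hin := hI.lt i hi
    exact ((hS i hin).card_le I hI hi hmin).trans (hmax i hin)

end Combinatorics

/-! ### Geometry -/

section Geometry

theorem not_disjoint_label {p q : Plane} : ¬ Disjoint (label p) (label q) ↔
    xc p ≤ xc q + 1 ∧ xc q ≤ xc p + 1 ∧ yc p ≤ yc q + 1 ∧ yc q ≤ yc p + 1 := by
  rw [Set.not_disjoint_iff]
  constructor
  · rintro ⟨r, ⟨h1, h2, h3, h4⟩, ⟨h5, h6, h7, h8⟩⟩
    exact ⟨by linarith, by linarith, by linarith, by linarith⟩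
  · rintro ⟨h1, h2, h3, h4⟩
    -- The lower left corner of the intersection of the two squares.
    refine ⟨!₂[max (xc p) (xc q), max (yc p) (yc q)], ?_, ?_⟩ <;>
      simp only [label, Set.mem_ofPred_eq, xc, yc] at * <;> simp <;> simp [*]

theorem not_disjoint_label_leader {p q : Plane} : ¬ Disjoint (label p) (leader q) ↔
    yc p ≤ yc q ∧ yc q ≤ yc p + 1 ∧ xc p ≤ xc q := by
  rw [Set.not_disjoint_iff]
  constructor
  · rintro ⟨r, ⟨h1, h2, h3, h4⟩, ⟨h5, h6⟩⟩
    exact ⟨by linarith, by linarith, by linarith⟩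
  · rintro ⟨h1, h2, h3⟩
    refine ⟨!₂[xc p, yc q], ?_, ?_⟩ <;>
      simp only [label, leader, Set.mem_ofPred_eq, xc, yc] at * <;> simp <;> simp [*]

variable {n : ℕ} (P : Fin n → Plane)

/-- The `x`-coordinates as read from the input. -/
noncomputable def inX (l : List ℝ) (i : ℕ) : ℝ := l.getD i 0

/-- The `y`-coordinates as read from the input. -/
noncomputable def inY (n : ℕ) (l : List ℝ) (i : ℕ) : ℝ := l.getD (n + i) 0

theorem length_encode : (encode P).length = 2 * n := by simp [encode]; omega

theorem inX_encode (i : Fin n) : inX (encode P) i = xc (P i) := by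
  simp [inX, encode, List.getD_eq_getElem?_getD, List.getElem?_append]

theorem inY_encode (i : Fin n) : inY n (encode P) i = yc (P i) := by
  simp [inY, encode, List.getD_eq_getElem?_getD]

variable {P}

theorem inY_injective (hP : Function.Injective fun i => yc (P i)) :
    ∀ i < n, ∀ j < n, inY n (encode P) i = inY n (encode P) j → i = j := fun i hi j hj h => by
  have := hP (a₁ := ⟨i, hi⟩) (a₂ := ⟨j, hj⟩) (by
    simpa [← inY_encode] using h)
  simpa using this

theorem conf_iff (i j : Fin n) : Conf (inX (encode P)) (inY n (encode P)) i j ↔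
    i ≠ j ∧ ¬ Disjoint (label (P i)) (label (P j)) := by
  simp only [Conf, inX_encode, inY_encode, not_disjoint_label, ne_eq, Fin.val_inj]

/-- `Force` has a strict inequality where the geometry gives a weak one; distinct heights remove the
difference. -/
theorem force_iff (hP : Function.Injective fun i => yc (P i)) (i j : Fin n) (hij : i ≠ j) :
    Force (inX (encode P)) (inY n (encode P)) i j ↔ ¬ Disjoint (label (P i)) (leader (P j)) := by
  simp only [Force, inX_encode, inY_encode, not_disjoint_label_leader]
  refine and_congr_left fun _ => ⟨le_of_lt, fun h => lt_of_le_of_ne h fun e => hij (hP e)⟩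

theorem IsLabeling.valid (hP : Function.Injective fun i => yc (P i)) {I E : Finset (Fin n)}
    (h : IsLabeling P I E) :
    Valid n (inX (encode P)) (inY n (encode P)) (I.map Fin.valEmbedding) where
  lt i hi := by
    obtain ⟨i, -, rfl⟩ := Finset.mem_map.1 hi
    exact i.2
  closed i hi j hj hf := by
    obtain ⟨i, hiI, rfl⟩ := Finset.mem_map.1 hi
    refine Finset.mem_map.2 ⟨⟨j, hj⟩, ?_, rfl⟩
    by_contra hjI
    have hjE : (⟨j, hj⟩ : Fin n) ∈ E := by
      rw [← h.partition.compl_eq]; exact Finset.mem_compl.2 hjI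
    exact (force_iff hP i ⟨j, hj⟩ fun e => hjI (e ▸ hiI)).1 hf (h.label_leader i hiI _ hjE)
  free i hi j hj hc := by
    obtain ⟨i, hiI, rfl⟩ := Finset.mem_map.1 hi
    obtain ⟨j, hjI, rfl⟩ := Finset.mem_map.1 hj
    have := (conf_iff i j).1 hc
    exact this.2 (h.labels i hiI j hjI this.1)

theorem Valid.isLabeling (hP : Function.Injective fun i => yc (P i)) {S : Finset ℕ}
    (h : Valid n (inX (encode P)) (inY n (encode P)) S) :
    IsLabeling P (Finset.univ.filter fun i : Fin n => (i : ℕ) ∈ S)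
      (Finset.univ.filter fun i : Fin n => (i : ℕ) ∉ S) where
  partition := by
    rw [Finset.filter_not, ← Finset.compl_eq_univ_sdiff]; exact isCompl_compl
  labels i hi j hj hij := by
    simp only [Finset.mem_filter, Finset.mem_univ, true_and] at hi hj
    by_contra hd
    exact h.free i hi j hj ((conf_iff i j).2 ⟨hij, hd⟩)
  leaders i _ j _ hij := Set.disjoint_left.2 fun q hq hq' => hij (hP (hq.1.symm.trans hq'.1))
  label_leader i hi j hj := by
    simp only [Finset.mem_filter, Finset.mem_univ, true_and] at hi hj
    by_contra hd
    exact hj (h.closed i hi j j.2 ((force_iff hP i j fun e => hj (e ▸ hi)).2 hd))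

theorem Valid.isMaxLabeling (hP : Function.Injective fun i => yc (P i)) {S : Finset ℕ}
    (h : Valid n (inX (encode P)) (inY n (encode P)) S)
    (hmax : ∀ I, Valid n (inX (encode P)) (inY n (encode P)) I → I.card ≤ S.card) :
    IsMaxLabeling P (Finset.univ.filter fun i : Fin n => (i : ℕ) ∈ S)
      (Finset.univ.filter fun i : Fin n => (i : ℕ) ∉ S) := by
  refine ⟨h.isLabeling hP, fun I' E' h' => ?_⟩
  have h1 := hmax _ (h'.valid hP)
  rw [Finset.card_map] at h1
  have h2 : S = (Finset.univ.filter fun i : Fin n => (i : ℕ) ∈ S).map Fin.valEmbedding := by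
    ext p
    simp only [Finset.mem_map, Finset.mem_filter, Finset.mem_univ, true_and,
      Fin.valEmbedding_apply]
    exact ⟨fun hp => ⟨⟨p, h.lt p hp⟩, hp, rfl⟩, by rintro ⟨i, hi, rfl⟩; exact hi⟩
  rw [h2, Finset.card_map] at h1
  exact h1

theorem density_nonneg : 0 ≤ density P :=
  le_min (Nat.cast_nonneg n) (one_div_nonneg.2
    (Real.sInf_nonneg (by rintro d ⟨i, j, -, rfl⟩; exact dist_nonneg)))

/-- Intersecting labels belong to points whose coordinates differ by at most 1 each, so their
distance is at most √2 and the minimum distance at most 2. -/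
theorem half_le_density (hn : 2 ≤ n) (hP : Function.Injective fun i => yc (P i)) {i j : Fin n}
    (h : Conf (inX (encode P)) (inY n (encode P)) i j) : 1 / 2 ≤ density P := by
  have hij := ((conf_iff i j).1 h).1
  simp only [Conf, inX_encode, inY_encode] at h
  obtain ⟨-, h1, h2, h3, h4⟩ := h
  set D : Set ℝ := {d : ℝ | ∃ i j : Fin n, i ≠ j ∧ d = dist (P i) (P j)} with hD
  have hfin : D.Finite := by
    refine (Set.finite_range fun ij : Fin n × Fin n => dist (P ij.1) (P ij.2)).subset ?_
    rintro d ⟨i, j, -, rfl⟩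
    exact ⟨(i, j), rfl⟩
  have hmem : dist (P i) (P j) ∈ D := ⟨i, j, hij, rfl⟩
  have hpos : 0 < minDist P := by
    obtain ⟨i, j, hij, h⟩ := Set.Nonempty.csInf_mem ⟨_, hmem⟩ hfin
    change 0 < sInf D
    rw [h, dist_pos]
    exact fun e => hij (hP (by simp [e]))
  have hle : minDist P ≤ 2 := by
    refine (csInf_le hfin.bddBelow hmem).trans ?_
    rw [EuclideanSpace.dist_eq, Fin.sum_univ_two]
    refine Real.sqrt_le_iff.2 ⟨by norm_num, ?_⟩
    rw [Real.dist_eq, Real.dist_eq, sq_abs, sq_abs]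
    simp only [xc, yc] at h1 h2 h3 h4
    nlinarith
  refine le_min ?_ (one_div_le_one_div_of_le hpos hle)
  have : (2 : ℝ) ≤ n := by exact_mod_cast hn
  linarith

end Geometry

end MixedLabeling

/-! ### Semantic rules for the loops that the algorithm uses. -/

namespace RealRAM

namespace Stmt

variable {n : ℕ} {l : List ℝ}

theorem exec_loop_induction {v : ℕ} {s : Stmt} {ρ : ℕ → ℕ} {σ : (ℕ → ℕ) × (ℕ → ℕ)}
    (I : ℕ → (ℕ → ℕ) × (ℕ → ℕ) → Prop) (h0 : I 0 σ)
    (hs : ∀ k < n, ∀ τ, I k τ → I (k + 1) (s.exec n l (Function.update ρ v k) τ)) :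
    I n ((loop v s).exec n l ρ σ) := by
  suffices H : ∀ k ≤ n, I k (Nat.rec σ (fun k τ => s.exec n l (Function.update ρ v k) τ) k) from
    H n le_rfl
  intro k
  induction k with
  | zero => exact fun _ => h0
  | succ k ih => exact fun hk => hs k hk _ (ih (by omega))

/-- A loop that fills the memory cells from `A` on. -/
theorem exec_loop_store {v A : ℕ} {a e : Expr} {ρ μ o : ℕ → ℕ} {f : ℕ → ℕ}
    (h : ∀ k < n, ∀ μ', (∀ x, (∀ j < k, x ≠ A + j) → μ' x = μ x) →
      a.eval n l (Function.update ρ v k) μ' = A + k ∧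
      e.eval n l (Function.update ρ v k) μ' = f k) :
    ∃ μ', (loop v (store a e)).exec n l ρ (μ, o) = (μ', o) ∧ (∀ k < n, μ' (A + k) = f k) ∧
      ∀ x, (∀ j < n, x ≠ A + j) → μ' x = μ x := by
  have := exec_loop_induction (n := n) (l := l) (v := v) (s := store a e) (ρ := ρ) (σ := (μ, o))
    (fun k τ => τ.2 = o ∧ (∀ j < k, τ.1 (A + j) = f j) ∧ ∀ x, (∀ j < k, x ≠ A + j) → τ.1 x = μ x)
    ⟨rfl, by simp, by simp⟩ (by
      rintro k hk ⟨μ', o'⟩ ⟨rfl, h1, h2⟩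
      obtain ⟨ha, he⟩ := h k hk μ' h2
      refine ⟨rfl, fun j hj => ?_, fun x hx => ?_⟩
      · simp only [exec, ha, he]
        rcases eq_or_ne j k with rfl | hjk
        · simp
        · rw [Function.update_of_ne (by omega)]
          exact h1 j (by omega)
      · simp only [exec, ha]
        rw [Function.update_of_ne (hx k (by omega))]
        exact h2 x fun j hj => hx j (by omega))
  exact ⟨_, Prod.ext rfl this.1, this.2⟩

/-- A loop that puts the `v` with the largest value into cell `B`. -/
theorem exec_loop_max {v B : ℕ} {a b e₁ e₂ : Expr} {ρ μ o : ℕ → ℕ} {f : ℕ → ℕ} (hn : 0 < n)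
    (ha₀ : ∀ μ, a.eval n l ρ μ = B) (ha : ∀ k μ, b.eval n l (Function.update ρ v k) μ = B)
    (h : ∀ k < n, ∀ c < n,
      e₁.eval n l (Function.update ρ v k) (Function.update μ B c) = f c ∧
      e₂.eval n l (Function.update ρ v k) (Function.update μ B c) = f k) :
    ∃ c < n, (seq (store a (.const 0)) (loop v (cond (.lt e₁ e₂) (store b (.var v))))).exec n l ρ
      (μ, o) = (Function.update μ B c, o) ∧ ∀ k < n, f k ≤ f c := by
  have := exec_loop_induction (n := n) (l := l) (v := v)
    (s := cond (.lt e₁ e₂) (store b (.var v))) (ρ := ρ) (σ := (Function.update μ B 0, o))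
    (fun k τ => ∃ c < n, τ = (Function.update μ B c, o) ∧ ∀ j < k, f j ≤ f c)
    ⟨0, hn, rfl, by simp⟩ (by
      rintro k hk _ ⟨c, hc, rfl, hmax⟩
      obtain ⟨h1, h2⟩ := h k hk c hc
      by_cases hlt : f c < f k
      · refine ⟨k, hk, by simp [exec, Expr.eval, h1, h2, hlt, ha], fun j hj => ?_⟩
        rcases (Nat.lt_succ_iff_lt_or_eq.1 hj) with hj | rfl
        · exact (hmax j hj).trans hlt.le
        · exact le_rfl
      · refine ⟨c, hc, by simp [exec, Expr.eval, h1, h2, hlt], fun j hj => ?_⟩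
        rcases (Nat.lt_succ_iff_lt_or_eq.1 hj) with hj | rfl
        · exact hmax j hj
        · exact not_lt.1 hlt)
  rw [exec]
  simpa [exec, Expr.eval, ha₀] using this

/-- A loop that puts the only `v` with property `p` into cell `B`. -/
theorem exec_loop_find {v B i : ℕ} {b e : Expr} {ρ μ o : ℕ → ℕ} {p : ℕ → Prop}
    (hb : ∀ k μ, b.eval n l (Function.update ρ v k) μ = B)
    (he : ∀ k < n, ∀ μ, 0 < e.eval n l (Function.update ρ v k) μ ↔ p k)
    (hi : i < n) (hpi : ∀ j < n, p j ↔ j = i) :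
    (loop v (cond e (store b (.var v)))).exec n l ρ (μ, o) = (Function.update μ B i, o) := by
  have := exec_loop_induction (n := n) (l := l) (v := v) (s := cond e (store b (.var v)))
    (ρ := ρ) (σ := (μ, o)) (fun k τ => τ = if i < k then (Function.update μ B i, o) else (μ, o))
    (by simp) (by
      rintro k hk τ rfl
      by_cases hki : k = i
      · subst hki
        simp [exec, he k hk, (hpi k hk).2, hb, Expr.eval]
      · have : i < k + 1 ↔ i < k := by omega
        simp [exec, he k hk, hpi k hk, hki, this])
  rwa [if_pos hi] at this

end Stmt

end RealRAM

namespace MixedLabeling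

open RealRAM

/-! ### Truth values as numbers -/

open Classical in
/-- The number `1` if `p` holds and `0` otherwise. -/
noncomputable def ind (p : Prop) : ℕ := if p then 1 else 0

theorem ind_pos {p : Prop} : 0 < ind p ↔ p := by unfold ind; split <;> simp [*]

theorem ind_mul (p q : Prop) : ind p * ind q = ind (p ∧ q) := by
  by_cases hp : p <;> by_cases hq : q <;> simp [ind, hp, hq]

theorem one_sub_ind (p : Prop) : 1 - ind p = ind ¬ p := by
  by_cases hp : p <;> simp [ind, hp]

theorem sum_ind_pos {n : ℕ} {p : ℕ → Prop} :
    0 < ∑ k ∈ Finset.range n, ind (p k) ↔ ∃ k < n, p k := by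
  rw [Finset.sum_pos_iff]
  simp [ind_pos]

open Classical in
theorem sum_ind {n : ℕ} (p : ℕ → Prop) :
    ∑ k ∈ Finset.range n, ind (p k) = ((Finset.range n).filter p).card := by
  rw [Finset.card_filter]
  rfl

theorem sum_ind_mem {n : ℕ} {A : Finset ℕ} (hA : ∀ p ∈ A, p < n) :
    ∑ k ∈ Finset.range n, ind (k ∈ A) = A.card := by
  rw [sum_ind]
  congr 1
  ext p
  simpa using hA p

/-! ### The algorithm -/

instance : Add Expr := ⟨.op .add⟩
instance : Sub Expr := ⟨.op .sub⟩
instance : Mul Expr := ⟨.op .mul⟩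

section Eval

variable {n : ℕ} {l : List ℝ} {ρ μ : ℕ → ℕ} (a b : Expr)

theorem eval_add : (a + b).eval n l ρ μ = a.eval n l ρ μ + b.eval n l ρ μ := rfl
theorem eval_sub : (a - b).eval n l ρ μ = a.eval n l ρ μ - b.eval n l ρ μ := rfl
theorem eval_mul : (a * b).eval n l ρ μ = a.eval n l ρ μ * b.eval n l ρ μ := rfl
theorem eval_const (k : ℕ) : (Expr.const k).eval n l ρ μ = k := rfl
theorem eval_size : Expr.size.eval n l ρ μ = n := rfl
theorem eval_var (r : ℕ) : (Expr.var r).eval n l ρ μ = ρ r := rfl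
theorem eval_load : (Expr.load a).eval n l ρ μ = μ (a.eval n l ρ μ) := rfl
theorem eval_lt : (Expr.lt a b).eval n l ρ μ = ind (a.eval n l ρ μ < b.eval n l ρ μ) := by
  simp [Expr.eval, ind]
theorem eval_eq : (Expr.eq a b).eval n l ρ μ = ind (a.eval n l ρ μ = b.eval n l ρ μ) := by
  simp [Expr.eval, ind]
theorem eval_cmp (z : ℤ) : (Expr.cmp z a b).eval n l ρ μ =
    ind (l.getD (a.eval n l ρ μ) 0 < l.getD (b.eval n l ρ μ) 0 + z) := by
  simp [Expr.eval, ind]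
theorem eval_sum (v : ℕ) : (Expr.sum v a).eval n l ρ μ =
    ∑ k ∈ Finset.range n, a.eval n l (Function.update ρ v k) μ := rfl

/-- Is the `y`-coordinate of `a` smaller than that of `b`? -/
def lowerE (a b : Expr) : Expr := .cmp 0 (.size + a) (.size + b)

/-- Is the input number at `a` at most one plus that at `b`? -/
def leAddOneE (a b : Expr) : Expr := .const 1 - .cmp (-1) b a

/-- On truth values, the product is conjunction and subtraction from 1 is negation. -/
def forceE (a b : Expr) : Expr :=
  lowerE a b * leAddOneE (.size + b) (.size + a) * (.const 1 - .cmp 0 b a)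

def confE (a b : Expr) : Expr :=
  (.const 1 - .eq a b) * leAddOneE a b * leAddOneE b a *
    leAddOneE (.size + a) (.size + b) * leAddOneE (.size + b) (.size + a)

def orE (a b : Expr) : Expr := .const 1 - (.const 1 - a) * (.const 1 - b)

theorem eval_lowerE : (lowerE a b).eval n l ρ μ =
    ind (inY n l (a.eval n l ρ μ) < inY n l (b.eval n l ρ μ)) := by
  simp [lowerE, eval_cmp, eval_add, eval_size, inY]

theorem eval_leAddOneE : (leAddOneE a b).eval n l ρ μ =
    ind (l.getD (a.eval n l ρ μ) 0 ≤ l.getD (b.eval n l ρ μ) 0 + 1) := by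
  -- The only available comparison is strict, so the weak one is the negation of the reverse
  -- comparison with offset -1.
  rw [leAddOneE, eval_sub, eval_const, eval_cmp, one_sub_ind, not_lt]
  congr 1
  push_cast
  rw [← sub_eq_add_neg, sub_le_iff_le_add]

theorem eval_forceE : (forceE a b).eval n l ρ μ =
    ind (Force (inX l) (inY n l) (a.eval n l ρ μ) (b.eval n l ρ μ)) := by
  rw [forceE, eval_mul, eval_mul, eval_lowerE, eval_leAddOneE, eval_sub, eval_const, eval_cmp,
    one_sub_ind, ind_mul, ind_mul]
  simp [Force, inX, inY, eval_add, eval_size, and_assoc]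

theorem eval_confE : (confE a b).eval n l ρ μ =
    ind (Conf (inX l) (inY n l) (a.eval n l ρ μ) (b.eval n l ρ μ)) := by
  simp only [confE, eval_mul, eval_leAddOneE, eval_sub, eval_const, eval_eq, one_sub_ind, ind_mul,
    Conf, inX, inY, eval_add, eval_size, and_assoc, ne_eq]

theorem eval_orE {p q : Prop} (hp : a.eval n l ρ μ = ind p) (hq : b.eval n l ρ μ = ind q) :
    (orE a b).eval n l ρ μ = ind (p ∨ q) := by
  simp only [orE, eval_sub, eval_mul, eval_const, hp, hq, one_sub_ind, ind_mul]
  congr 1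
  exact propext (by tauto)

end Eval

/-- The address of entry `(a, b)` of the first table. -/
def entry (a b : Expr) : Expr := a * .size + b

/-- The address of the cell for the point that is treated. -/
def curA : Expr := .size * .size + (.size * .size + .size * .size)

/-- The address of the cell for the best candidate. -/
def bestA : Expr := .const 1 + curA

/-- The entry `(a, b)` of the first table: is `b` in the set of points forced by `a`? -/
def tabR (a b : Expr) : Expr := .load (entry a b)

/-- The entry `(a, b)` of the second table: is `b` in the best set with lowest point `a`? -/
def tabS (a b : Expr) : Expr := .load (.size * .size + entry a b)

/-- Does `a` have a conflict with the points forced by the current point? -/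
def tabT (a : Expr) : Expr := .load (.size * .size + .size * .size + a)

def curE : Expr := .load curA

def bestE : Expr := .load bestA

/-- The score of the row `a` of the second table as a candidate for the current point. -/
def scoreE (a : Expr) : Expr :=
  .lt (.sum 20 (orE (tabR curE (.var 20)) (tabS a (.var 20)) * tabT (.var 20))) (.const 1) *
    .sum 20 (orE (tabR curE (.var 20)) (tabS a (.var 20)))

/-- Find the point with exactly `var 1` points above it. -/
def findCur : Stmt :=
  .loop 2 (.cond (.eq (.sum 20 (lowerE (.var 2) (.var 20))) (.var 1)) (.store curA (.var 2)))

/-- Recursion on the first forcing step: besides itself, the current point reaches what the points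
it forces reach, and their rows are already complete because they are higher. -/
def fillR : Stmt :=
  .loop 2 (.store (entry curE (.var 2))
    (.lt (.const 0) (.eq (.var 2) curE +
      .sum 20 (forceE curE (.var 20) * tabR (.var 20) (.var 2)))))

/-- Computed once per round, this row makes the scoring of a candidate linear, which keeps a round
quadratic. -/
def fillT : Stmt :=
  .loop 2 (.store (.size * .size + .size * .size + .var 2)
    (.lt (.const 0) (.sum 20 (tabR curE (.var 20) * confE (.var 20) (.var 2)))))

def findBest : Stmt :=
  .seq (.store bestA (.const 0))
    (.loop 2 (.cond (.lt (scoreE bestE) (scoreE (.var 2))) (.store bestA (.var 2))))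

/-- If the best score is zero, the row keeps its initial zeros and represents the empty set. -/
def fillS : Stmt :=
  .cond (scoreE bestE) (.loop 2 (.store (.size * .size + entry curE (.var 2))
    (orE (tabR curE (.var 2)) (tabS bestE (.var 2)))))

def round : Stmt := .seq findCur (.seq fillR (.seq fillT (.seq findBest fillS)))

def findLargest : Stmt :=
  .seq (.store bestA (.const 0))
    (.loop 1 (.cond (.lt (.sum 20 (tabS bestE (.var 20))) (.sum 20 (tabS (.var 1) (.var 20))))
      (.store bestA (.var 1))))

def outputBest : Stmt := .loop 1 (.out (.var 1) (tabS bestE (.var 1)))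

def solve : Stmt := .seq (.loop 1 round) (.seq findLargest outputBest)

def outputAll : Stmt := .loop 1 (.out (.var 1) (.const 1))

/-- The number of pairs of points with intersecting labels. -/
def conflictsE : Expr := .sum 20 (.sum 40 (confE (.var 20) (.var 40)))

/-- The complementary second guard plays the role of an else branch. Only `solve` uses working
memory. -/
def algorithm : Stmt :=
  .seq (.cond conflictsE solve) (.cond (.lt conflictsE (.const 1)) outputAll)

/-! ### Word and memory limits of the algorithm. -/

section Ok

variable {W m n : ℕ}

theorem bound_sub (a b : Expr) : (a - b).bound n = a.bound n := rfl

theorem ok_sub {V : List ℕ} {c : ℕ} (a b : Expr) : (a - b).Ok W m n V c ↔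
    a.bound n < W ∧ a.Ok W m n V c ∧ b.Ok W m n V (c + 1) := by
  change _ ≠ _ ∧ _ ↔ _
  simp [Expr.bound]

/-- The memory limit `m` is arbitrary, in particular possibly 0, as the expression loads nothing. -/
theorem ok_conflictsE (hn : 2 ≤ n) (hW : 8 * (n * n) ≤ W) : conflictsE.Ok W m n [] 1 := by
  have h1 : 2 * n ≤ n * n := Nat.mul_le_mul_right n hn
  simp only [conflictsE, confE, leAddOneE, Expr.Ok, ok_sub, Expr.bound, bound_sub]
  simp
  omega

theorem ok_outputAll (hn : 2 ≤ n) (hW : 8 * (n * n) ≤ W) : outputAll.Ok W m n [] 1 := by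
  have h1 : 2 * n ≤ n * n := Nat.mul_le_mul_right n hn
  simp [outputAll, Stmt.Ok, Expr.Ok]
  omega

/-- Two tables of `n * n` cells are followed by the row of conflict marks; the largest address is `3
* n * n + 1`, that of the best candidate. -/
theorem ok_algorithm (hn : 2 ≤ n) (hW : 8 * (n * n) ≤ W) :
    algorithm.Ok W (4 * (n * n)) n [] 1 := by
  refine ⟨⟨ok_conflictsE hn hW, ?_⟩, ⟨ok_conflictsE hn hW, ?_⟩, ok_outputAll hn hW⟩
  · have h1 : 2 * n ≤ n * n := Nat.mul_le_mul_right n hn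
    have h2 : (n - 1) * n ≤ n * n := Nat.mul_le_mul_right n (Nat.sub_le n 1)
    have h3 : n * (n - 1) ≤ n * n := Nat.mul_le_mul_left n (Nat.sub_le n 1)
    simp only [solve, round, findCur, fillR, fillT, findBest, fillS, findLargest, outputBest, scoreE,
      tabR, tabS, tabT, curE, bestE, curA, bestA, entry, orE, lowerE, confE, forceE, leAddOneE,
      Stmt.Ok, Expr.Ok, ok_sub, Expr.bound, bound_sub]
    simp
    omega
  · change 1 < W
    nlinarith

end Ok

end MixedLabeling

namespace MixedLabeling

open RealRAM

/-! ### Correctness of one round and of the whole dynamic program. -/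

section Round

variable {n : ℕ} {X Y : ℕ → ℝ}

open Classical in
/-- The number of points above `i`. -/
noncomputable def rank (n : ℕ) (Y : ℕ → ℝ) (i : ℕ) : ℕ :=
  ((Finset.range n).filter fun j => Y i < Y j).card

theorem rank_eq_sum (i : ℕ) : ∑ j ∈ Finset.range n, ind (Y i < Y j) = rank n Y i := by
  rw [sum_ind, rank]

theorem rank_lt {i : ℕ} (hi : i < n) : rank n Y i < n := by
  classical
  have : (Finset.range n).filter (fun j => Y i < Y j) ⊂ Finset.range n :=
    Finset.filter_ssubset.2 ⟨i, Finset.mem_range.2 hi, lt_irrefl _⟩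
  simpa [rank] using Finset.card_lt_card this

theorem rank_lt_rank {i j : ℕ} (hi : i < n) (h : Y j < Y i) : rank n Y i < rank n Y j := by
  classical
  refine Finset.card_lt_card (Finset.ssubset_iff_of_subset ?_ |>.2 ⟨i, ?_, ?_⟩)
  · intro k hk
    rw [Finset.mem_filter] at hk ⊢
    exact ⟨hk.1, h.trans hk.2⟩
  · simp [hi, h]
  · simp

theorem rank_lt_rank_iff {i j : ℕ} (hi : i < n) (hj : j < n) :
    rank n Y i < rank n Y j ↔ Y j < Y i := by
  refine ⟨fun h => ?_, rank_lt_rank hi⟩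
  by_contra hle
  rcases (not_lt.1 hle).lt_or_eq with h' | h'
  · exact h.not_gt (rank_lt_rank hj h')
  · exact h.ne (by rw [rank, rank, h'])

theorem rank_injOn (hY : ∀ i < n, ∀ j < n, Y i = Y j → i = j) {i j : ℕ} (hi : i < n) (hj : j < n)
    (h : rank n Y i = rank n Y j) : i = j := by
  refine hY i hi j hj (le_antisymm ?_ ?_) <;> refine not_lt.1 fun h' => ?_
  · exact (rank_lt_rank hi h').ne h
  · exact (rank_lt_rank hj h').ne h.symm

/-- An injective map from a finite set to itself is surjective. Each round can therefore find its
point by counting, without sorting. -/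
theorem exists_rank_eq (hY : ∀ i < n, ∀ j < n, Y i = Y j → i = j) {k : ℕ} (hk : k < n) :
    ∃ i < n, rank n Y i = k := by
  have hsurj := Finset.surjOn_of_injOn_of_card_le (s := Finset.range n) (t := Finset.range n)
    (rank n Y) (fun i hi => by simpa using rank_lt (by simpa using hi))
    (fun i hi j hj h => rank_injOn hY (by simpa using hi) (by simpa using hj) h) le_rfl
  obtain ⟨i, hi, h⟩ := hsurj (by simpa using hk : k ∈ (Finset.range n : Set ℕ))
  exact ⟨i, by simpa using hi, h⟩

theorem entry_lt {i p : ℕ} (hi : i < n) (hp : p < n) : i * n + p < n * n := by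
  have : (i + 1) * n ≤ n * n := Nat.mul_le_mul_right n hi
  rw [Nat.succ_mul] at this
  omega

theorem entry_inj {i p j q : ℕ} (hp : p < n) (hq : q < n) (h : i * n + p = j * n + q) : i = j := by
  have h1 : (i * n + p) / n = i := by
    rw [Nat.mul_comm, Nat.mul_add_div (by omega), Nat.div_eq_of_lt hp, Nat.add_zero]
  have h2 : (j * n + q) / n = j := by
    rw [Nat.mul_comm, Nat.mul_add_div (by omega), Nat.div_eq_of_lt hq, Nat.add_zero]
  rw [← h1, h, h2]

/-- The contents of the tables after the points with fewer than `k` points above have been treated,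
where row `i` of the second table represents `S i`. -/
structure Tables (n : ℕ) (X Y : ℕ → ℝ) (k : ℕ) (S : ℕ → Finset ℕ) (μ : ℕ → ℕ) : Prop where
  reach : ∀ i < n, rank n Y i < k → ∀ p < n, μ (i * n + p) = ind (Reach n X Y i p)
  best : ∀ i < n, ∀ p < n, μ (n * n + (i * n + p)) = ind (p ∈ S i)
  isBest : ∀ i < n, rank n Y i < k → IsBest n X Y i (S i)
  empty : ∀ i < n, k ≤ rank n Y i → S i = ∅

theorem Tables.lt {k : ℕ} {S : ℕ → Finset ℕ} {μ : ℕ → ℕ} (h : Tables n X Y k S μ) {i p : ℕ}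
    (hi : i < n) (hp : p ∈ S i) : p < n := by
  rcases lt_or_ge (rank n Y i) k with hk | hk
  · exact (h.isBest i hi hk).valid.lt p hp
  · simp [h.empty i hi hk] at hp

theorem reach_iff {i p : ℕ} : Reach n X Y i p ↔
    p = i ∨ ∃ j < n, Force X Y i j ∧ Reach n X Y j p := by
  rw [Reach, Relation.ReflTransGen.cases_head_iff]
  refine or_congr eq_comm ⟨?_, ?_⟩
  · rintro ⟨j, ⟨hj, hf⟩, h⟩
    exact ⟨j, hj, hf, h⟩
  · rintro ⟨j, hj, hf, h⟩
    exact ⟨j, ⟨hj, hf⟩, h⟩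

variable {l : List ℝ} {ρ μ o : ℕ → ℕ}

theorem exec_findCur (hY : ∀ i < n, ∀ j < n, inY n l i = inY n l j → i = j) {k i : ℕ}
    (hρ : ρ 1 = k) (hi : i < n) (hk : rank n (inY n l) i = k) :
    findCur.exec n l ρ (μ, o) = (Function.update μ (n * n + (n * n + n * n)) i, o) := by
  refine Stmt.exec_loop_find (p := fun j => rank n (inY n l) j = k) (fun _ _ => rfl) ?_ hi ?_
  · intro j hj μ'
    simp [eval_eq, eval_sum, eval_lowerE, eval_var, ind_pos, hρ, rank_eq_sum]
  · exact fun j hj => ⟨fun h => rank_injOn hY hj hi (h.trans hk.symm), fun h => h ▸ hk⟩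

theorem exec_fillR {c : ℕ} (hc : c < n) (hcur : μ (n * n + (n * n + n * n)) = c)
    (hμ : ∀ i < n, inY n l c < inY n l i → ∀ p < n,
      μ (i * n + p) = ind (Reach n (inX l) (inY n l) i p)) :
    ∃ μ', fillR.exec n l ρ (μ, o) = (μ', o) ∧
      (∀ p < n, μ' (c * n + p) = ind (Reach n (inX l) (inY n l) c p)) ∧
      ∀ x, (∀ j < n, x ≠ c * n + j) → μ' x = μ x := by
  refine Stmt.exec_loop_store fun p hp μ' hμ' => ?_
  have hcur' : curE.eval n l (Function.update ρ 2 p) μ' = c := by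
    refine (hμ' (n * n + (n * n + n * n)) fun j hj => ?_).trans hcur
    have := entry_lt hc (hj.trans hp)
    omega
  refine ⟨?_, ?_⟩
  · simp [entry, eval_add, eval_mul, eval_size, eval_var, hcur']
  · have hsum : ∀ j ∈ Finset.range n,
        (forceE curE (.var 20) * tabR (.var 20) (.var 2)).eval n l
          (Function.update (Function.update ρ 2 p) 20 j) μ' =
        ind (Force (inX l) (inY n l) c j ∧ Reach n (inX l) (inY n l) j p) := fun j hj => by
      have hj := Finset.mem_range.1 hj
      have hcur'' : curE.eval n l (Function.update (Function.update ρ 2 p) 20 j) μ' = c := hcur'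
      rw [eval_mul, eval_forceE, hcur'', ← ind_mul]
      simp only [tabR, entry, eval_load, eval_add, eval_mul, eval_size, eval_var,
        Function.update_self, Function.update_of_ne (show 2 ≠ 20 by decide)]
      -- Rows of points that are not forced may be incomplete or under construction, but the factor
      -- 0 cancels them. A forced point is strictly higher than `c`, so its row is complete and is
      -- not the row being written.
      by_cases hf : Force (inX l) (inY n l) c j
      · congr 1
        rw [hμ' _ fun q hq h => ?_, hμ j hj hf.1 p hp]
        have := entry_inj hp (hq.trans hp) h
        subst this
        exact lt_irrefl _ hf.1
      · simp [ind, hf]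
    rw [eval_lt, eval_add, eval_eq, eval_sum, Finset.sum_congr rfl hsum, hcur', eval_const,
      reach_iff, Nat.add_pos_iff_pos_or_pos, ind_pos, sum_ind_pos]
    simp [eval_var]

theorem exec_fillT {c : ℕ} {R : Finset ℕ} (hc : c < n) (hcur : μ (n * n + (n * n + n * n)) = c)
    (hR : ∀ p ∈ R, p < n) (hμ : ∀ p < n, μ (c * n + p) = ind (p ∈ R)) :
    ∃ μ', fillT.exec n l ρ (μ, o) = (μ', o) ∧
      (∀ p < n, μ' (n * n + n * n + p) = ind (∃ i ∈ R, Conf (inX l) (inY n l) i p)) ∧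
      ∀ x, (∀ j < n, x ≠ n * n + n * n + j) → μ' x = μ x := by
  refine Stmt.exec_loop_store fun p hp μ' hμ' => ⟨by simp [eval_add, eval_mul, eval_size, eval_var],
    ?_⟩
  have hnn : n ≤ n * n := Nat.le_mul_self n
  have hsum : ∀ i ∈ Finset.range n,
      (tabR curE (.var 20) * confE (.var 20) (.var 2)).eval n l
        (Function.update (Function.update ρ 2 p) 20 i) μ' =
      ind (i ∈ R ∧ Conf (inX l) (inY n l) i p) := fun i hi => by
    have hi := Finset.mem_range.1 hi
    have hcur' : curE.eval n l (Function.update (Function.update ρ 2 p) 20 i) μ' = c :=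
      (hμ' (n * n + (n * n + n * n)) fun j hj => by omega).trans hcur
    rw [eval_mul, eval_confE, ← ind_mul]
    simp only [tabR, entry, eval_load, eval_add, eval_mul, eval_size, eval_var, hcur',
      Function.update_self, Function.update_of_ne (show 2 ≠ 20 by decide)]
    rw [hμ' _ fun j hj => ?_, hμ i hi]
    have := entry_lt hc hi
    omega
  rw [eval_lt, eval_sum, Finset.sum_congr rfl hsum, eval_const, sum_ind_pos]
  congr 1
  exact propext ⟨fun ⟨i, _, hi, h⟩ => ⟨i, hi, h⟩, fun ⟨i, hi, h⟩ => ⟨i, hR i hi, hi, h⟩⟩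

theorem eval_scoreE {c q : ℕ} {R S : Finset ℕ} {a : Expr}
    (ha : ∀ p, a.eval n l (Function.update ρ 20 p) μ = q)
    (hcur : μ (n * n + (n * n + n * n)) = c)
    (hR : ∀ p ∈ R, p < n) (hμR : ∀ p < n, μ (c * n + p) = ind (p ∈ R))
    (hS : ∀ p ∈ S, p < n) (hμS : ∀ p < n, μ (n * n + (q * n + p)) = ind (p ∈ S))
    (hμT : ∀ p < n, μ (n * n + n * n + p) = ind (∃ i ∈ R, Conf (inX l) (inY n l) i p)) :
    (scoreE a).eval n l ρ μ = score (inX l) (inY n l) R S := by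
  have hor : ∀ p ∈ Finset.range n, (orE (tabR curE (.var 20)) (tabS a (.var 20))).eval n l
      (Function.update ρ 20 p) μ = ind (p ∈ R ∪ S) := fun p hp => by
    have hp := Finset.mem_range.1 hp
    rw [eval_orE (p := p ∈ R) (q := p ∈ S), Finset.mem_union]
    · simp only [tabR, entry, eval_load, eval_add, eval_mul, eval_size, eval_var, curE, curA, hcur,
        Function.update_self, hμR p hp]
    · simp only [tabS, entry, eval_load, eval_add, eval_mul, eval_size, eval_var, ha,
        Function.update_self, hμS p hp]
  have hconf : ∀ p ∈ Finset.range n, (orE (tabR curE (.var 20)) (tabS a (.var 20)) *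
      tabT (.var 20)).eval n l (Function.update ρ 20 p) μ =
      ind (p ∈ R ∪ S ∧ ∃ i ∈ R, Conf (inX l) (inY n l) i p) := fun p hp => by
    rw [eval_mul, hor p hp, ← ind_mul]
    simp only [tabT, eval_load, eval_add, eval_mul, eval_size, eval_var, Function.update_self,
      hμT p (Finset.mem_range.1 hp)]
  have hRS : ∀ p ∈ R ∪ S, p < n := fun p hp => (Finset.mem_union.1 hp).elim (hR p) (hS p)
  have hfree : ∑ p ∈ Finset.range n, ind (p ∈ R ∪ S ∧ ∃ i ∈ R, Conf (inX l) (inY n l) i p) < 1 ↔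
      Free (inX l) (inY n l) R S := by
    rw [Nat.lt_one_iff, ← not_iff_not, ← ne_eq, ← Nat.pos_iff_ne_zero, sum_ind_pos]
    constructor
    · rintro ⟨p, -, hp, i, hi, h⟩ hf
      exact hf p hp i hi h
    · intro hf
      simp only [Free, not_forall, not_not] at hf
      obtain ⟨p, hp, i, hi, h⟩ := hf
      exact ⟨p, hRS p hp, hp, i, hi, h⟩
  rw [scoreE, eval_mul, eval_lt, eval_sum, eval_sum, Finset.sum_congr rfl hor,
    Finset.sum_congr rfl hconf, eval_const, hfree, sum_ind_mem hRS, score, ind]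
  split <;> simp

theorem exec_round (hY : ∀ i < n, ∀ j < n, inY n l i = inY n l j → i = j) {k : ℕ} (hk : k < n)
    (hρ : ρ 1 = k) {S : ℕ → Finset ℕ} (h : Tables n (inX l) (inY n l) k S μ) :
    ∃ μ' S', round.exec n l ρ (μ, o) = (μ', o) ∧
      Tables n (inX l) (inY n l) (k + 1) S' μ' := by
  obtain ⟨c, hc, hck⟩ := exists_rank_eq hY hk
  have hnn' : n ≤ n * n := Nat.le_mul_self n
  have hdone : ∀ q < n, inY n l c < inY n l q → rank n (inY n l) q < k := fun q hq hlt =>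
    hck ▸ rank_lt_rank hq hlt
  have hundone : ∀ q < n, ¬ inY n l c < inY n l q → k ≤ rank n (inY n l) q := fun q hq hlt => by
    rw [← hck]; exact not_lt.1 fun h => hlt ((rank_lt_rank_iff hq hc).1 h)
  have e₁ := exec_findCur (μ := μ) (o := o) hY hρ hc hck
  set μ₁ := Function.update μ (n * n + (n * n + n * n)) c with hμ₁
  have hμ₁' : ∀ x < n * n + (n * n + n * n), μ₁ x = μ x := fun x hx =>
    Function.update_of_ne hx.ne _ _
  have hcur₁ : μ₁ (n * n + (n * n + n * n)) = c := by simp [hμ₁]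
  obtain ⟨μ₂, e₂, hR₂, hμ₂⟩ := exec_fillR (ρ := ρ) (o := o) hc hcur₁ fun i hi hlt p hp => by
    have := entry_lt hi hp
    rw [hμ₁' _ (by omega), h.reach i hi (hdone i hi hlt) p hp]
  set R := reachSet n (inX l) (inY n l) c with hRdef
  have hRn : ∀ p ∈ R, p < n := fun p hp => ((mem_reachSet hc).1 hp).lt hc
  have hμ₂' : ∀ x, n * n ≤ x → μ₂ x = μ₁ x := fun x hx => hμ₂ x fun j hj => by
    have := entry_lt hc hj
    omega
  simp only [← mem_reachSet hc, ← hRdef] at hR₂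
  obtain ⟨μ₃, e₃, hT₃, hμ₃⟩ := exec_fillT (ρ := ρ) (o := o) hc
    ((hμ₂' _ (by omega)).trans hcur₁) hRn hR₂
  have hμ₃' : ∀ x < n * n + n * n, μ₃ x = μ₂ x := fun x hx => hμ₃ x fun j hj => by omega
  have hS₃ : ∀ i < n, ∀ p < n, μ₃ (n * n + (i * n + p)) = ind (p ∈ S i) := fun i hi p hp => by
    have := entry_lt hi hp
    rw [hμ₃' _ (by omega), hμ₂' _ (by omega), hμ₁' _ (by omega), h.best i hi p hp]
  have hcur₃ : μ₃ (n * n + (n * n + n * n)) = c := by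
    rw [hμ₃ _ fun j hj => by omega, hμ₂' _ (by omega), hcur₁]
  have hscore : ∀ (μ' ρ' : ℕ → ℕ) (a : Expr) (q : ℕ), q < n →
      (∀ x ≤ n * n + (n * n + n * n), μ' x = μ₃ x) →
      (∀ p, a.eval n l (Function.update ρ' 20 p) μ' = q) →
      (scoreE a).eval n l ρ' μ' = score (inX l) (inY n l) R (S q) := by
    intro μ' ρ' a q hq hμ' ha
    refine eval_scoreE ha (by rw [hμ' _ (by omega), hcur₃]) hRn (fun p hp => ?_)
      (fun p => h.lt hq) (fun p hp => ?_) (fun p hp => ?_)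
    · have := entry_lt hc hp
      rw [hμ' _ (by omega), hμ₃' _ (by omega), hR₂ p hp]
    · have := entry_lt hq hp
      rw [hμ' _ (by omega), hS₃ q hq p hp]
    · rw [hμ' _ (by omega), hT₃ p hp]
  obtain ⟨b, hb, e₄, hmax⟩ := Stmt.exec_loop_max (l := l) (v := 2)
    (B := 1 + (n * n + (n * n + n * n))) (a := bestA) (b := bestA) (e₁ := scoreE bestE)
    (e₂ := scoreE (.var 2)) (ρ := ρ) (μ := μ₃) (o := o)
    (f := fun q => score (inX l) (inY n l) R (S q)) (by omega) (fun _ => rfl) (fun _ _ => rfl)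
    (fun q hq c' hc' => by
      have hlow : ∀ x ≤ n * n + (n * n + n * n),
          Function.update μ₃ (1 + (n * n + (n * n + n * n))) c' x = μ₃ x := fun x hx =>
        Function.update_of_ne (by omega) _ _
      refine ⟨hscore _ _ _ c' hc' hlow fun p => ?_, hscore _ _ _ q hq hlow fun p => ?_⟩
      · exact Function.update_self _ _ _
      · simp [eval_var])
  set μ₄ := Function.update μ₃ (1 + (n * n + (n * n + n * n))) b with hμ₄
  have hμ₄' : ∀ x ≤ n * n + (n * n + n * n), μ₄ x = μ₃ x := fun x hx =>
    Function.update_of_ne (by omega) _ _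
  have hbest₄ : μ₄ (1 + (n * n + (n * n + n * n))) = b := Function.update_self _ _ _
  have hscore₄ : (scoreE bestE).eval n l ρ μ₄ = score (inX l) (inY n l) R (S b) :=
    hscore μ₄ ρ bestE b hb hμ₄' fun p => hbest₄
  have hnew := isBest_of_score hY hc (fun q hq hlt => h.isBest q hq (hdone q hq hlt))
    (fun q hq hlt => h.empty q hq (hundone q hq hlt)) hb hmax
  rw [← hRdef] at hnew
  have hfill : ∃ μ₅, fillS.exec n l ρ (μ₄, o) = (μ₅, o) ∧
      (∀ p < n, μ₅ (n * n + c * n + p) =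
        ind (p ∈ if 0 < score (inX l) (inY n l) R (S b) then R ∪ S b else ∅)) ∧
      ∀ x, (∀ j < n, x ≠ n * n + c * n + j) → μ₅ x = μ₄ x := by
    by_cases hpos : 0 < score (inX l) (inY n l) R (S b)
    · rw [fillS, Stmt.exec, if_pos (by rw [hscore₄]; exact hpos), if_pos hpos]
      refine Stmt.exec_loop_store fun p hp μ' hμ' => ?_
      have hcur' : curE.eval n l (Function.update ρ 2 p) μ' = c := by
        refine (hμ' (n * n + (n * n + n * n)) fun j hj => ?_).trans
          ((hμ₄' _ le_rfl).trans hcur₃)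
        have := entry_lt hc (hj.trans hp)
        omega
      have hbest' : bestE.eval n l (Function.update ρ 2 p) μ' = b := by
        refine (hμ' (1 + (n * n + (n * n + n * n))) fun j hj => ?_).trans hbest₄
        have := entry_lt hc (hj.trans hp)
        omega
      refine ⟨by simp [entry, eval_add, eval_mul, eval_size, eval_var, hcur', Nat.add_assoc], ?_⟩
      rw [eval_orE (p := p ∈ R) (q := p ∈ S b), Finset.mem_union]
      · simp only [tabR, entry, eval_load, eval_add, eval_mul, eval_size, eval_var, hcur',
          Function.update_self]
        have := entry_lt hc hp
        rw [hμ' _ fun j hj => by omega, hμ₄' _ (by omega), hμ₃' _ (by omega), hR₂ p hp]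
      · simp only [tabS, entry, eval_load, eval_add, eval_mul, eval_size, eval_var, hbest',
          Function.update_self]
        have := entry_lt hb hp
        -- The row that is read may be the row that is written, namely if `b = c`; even then cell
        -- `p` is read before it is overwritten.
        rw [hμ' _ fun j hj he => ?_, hμ₄' _ (by omega), hS₃ b hb p hp]
        have hbc : b = c := entry_inj hp (hj.trans hp) (by omega)
        subst hbc
        omega
    · rw [fillS, Stmt.exec, if_neg (by rw [hscore₄]; exact hpos), if_neg hpos]
      refine ⟨μ₄, rfl, fun p hp => ?_, fun _ _ => rfl⟩
      have := entry_lt hc hp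
      rw [hμ₄' _ (by omega), Nat.add_assoc, hS₃ c hc p hp, h.empty c hc hck.ge]
  obtain ⟨μ₅, e₅, hS₅, hμ₅⟩ := hfill
  refine ⟨μ₅, Function.update S c (if 0 < score (inX l) (inY n l) R (S b) then R ∪ S b else ∅),
    ?_, ?_⟩
  · rw [round, Stmt.exec, e₁, Stmt.exec, e₂, Stmt.exec, e₃, Stmt.exec, findBest, e₄, e₅]
  have hrank : ∀ i < n, i ≠ c → rank n (inY n l) i < k + 1 → rank n (inY n l) i < k :=
    fun i hi hic h => lt_of_le_of_ne (Nat.lt_succ_iff.1 h) fun he =>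
      hic (rank_injOn hY hi hc (he.trans hck.symm))
  refine ⟨fun i hi hik p hp => ?_, fun i hi p hp => ?_, fun i hi hik => ?_, fun i hi hik => ?_⟩
  · have := entry_lt hi hp
    rw [hμ₅ _ fun j hj => by omega, hμ₄' _ (by omega), hμ₃' _ (by omega)]
    rcases eq_or_ne i c with rfl | hic
    · rw [hR₂ p hp, hRdef, mem_reachSet hc]
    · rw [hμ₂ _ fun j hj he => hic (entry_inj hp hj he), hμ₁' _ (by omega),
        h.reach i hi (hrank i hi hic hik) p hp]
  · rcases eq_or_ne i c with rfl | hic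
    · rw [Function.update_self, ← hS₅ p hp, Nat.add_assoc]
    · have := entry_lt hi hp
      rw [Function.update_of_ne hic, hμ₅ _ fun j hj he => hic (entry_inj hp hj (by omega)),
        hμ₄' _ (by omega), hS₃ i hi p hp]
  · rcases eq_or_ne i c with rfl | hic
    · rw [Function.update_self]; exact hnew
    · rw [Function.update_of_ne hic]; exact h.isBest i hi (hrank i hi hic hik)
  · have hic : i ≠ c := fun he => by rw [he, hck] at hik; omega
    rw [Function.update_of_ne hic]
    exact h.empty i hi (by omega)

theorem exec_solve (hn : 2 ≤ n) (hY : ∀ i < n, ∀ j < n, inY n l i = inY n l j → i = j) :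
    ∃ μ' o' S, solve.exec n l ρ (fun _ => 0, fun _ => 0) = (μ', o') ∧
      Valid n (inX l) (inY n l) S ∧ (∀ I, Valid n (inX l) (inY n l) I → I.card ≤ S.card) ∧
      ∀ p < n, o' p = ind (p ∈ S) := by
  have h1 := Stmt.exec_loop_induction (n := n) (l := l) (v := 1) (s := round) (ρ := ρ)
    (σ := (fun _ => 0, fun _ => 0))
    (fun k τ => τ.2 = (fun _ => 0) ∧ ∃ S, Tables n (inX l) (inY n l) k S τ.1)
    -- Initially all memory is zero, so every row of the second table represents the empty set.
    ⟨rfl, fun _ => ∅, by simp, by simp [ind], by simp, by simp⟩ (by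
      rintro k hk ⟨μ, o⟩ ⟨rfl, S, hS⟩
      obtain ⟨μ', S', he, h'⟩ := exec_round (ρ := Function.update ρ 1 k) (o := fun _ => 0) hY hk
        (by simp) hS
      rw [he]
      exact ⟨rfl, S', h'⟩)
  set τ := (Stmt.loop 1 round).exec n l ρ (fun _ => 0, fun _ => 0) with hτ
  obtain ⟨ho, S, hS⟩ := h1
  have hτ' : τ = (τ.1, fun _ => 0) := Prod.ext rfl ho
  have hrow : ∀ (μ' ρ' : ℕ → ℕ) (a : Expr) (q : ℕ), q < n →
      (∀ x < n * n + (n * n + n * n), μ' x = τ.1 x) →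
      (∀ p, a.eval n l (Function.update ρ' 20 p) μ' = q) →
      (Expr.sum 20 (tabS a (.var 20))).eval n l ρ' μ' = (S q).card := by
    intro μ' ρ' a q hq hμ' ha
    rw [eval_sum, ← sum_ind_mem fun p => hS.lt hq]
    refine Finset.sum_congr rfl fun p hp => ?_
    have hp := Finset.mem_range.1 hp
    have := entry_lt hq hp
    simp only [tabS, entry, eval_load, eval_add, eval_mul, eval_size, eval_var, ha,
      Function.update_self]
    rw [hμ' _ (by omega), hS.best q hq p hp]
  obtain ⟨b, hb, he, hmax⟩ := Stmt.exec_loop_max (l := l) (v := 1)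
    (B := 1 + (n * n + (n * n + n * n))) (a := bestA) (b := bestA)
    (e₁ := .sum 20 (tabS bestE (.var 20))) (e₂ := .sum 20 (tabS (.var 1) (.var 20))) (ρ := ρ)
    (μ := τ.1) (o := fun _ => 0) (f := fun q => (S q).card) (by omega) (fun _ => rfl)
    (fun _ _ => rfl)
    (fun q hq c' hc' => by
      have hlow : ∀ x < n * n + (n * n + n * n),
          Function.update τ.1 (1 + (n * n + (n * n + n * n))) c' x = τ.1 x := fun x hx =>
        Function.update_of_ne (by omega) _ _
      refine ⟨hrow _ _ _ c' hc' hlow fun p => ?_, hrow _ _ _ q hq hlow fun p => ?_⟩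
      · exact Function.update_self _ _ _
      · simp [eval_var])
  set μ' := Function.update τ.1 (1 + (n * n + (n * n + n * n))) b with hμ'
  have h2 := Stmt.exec_loop_induction (n := n) (l := l) (v := 1)
    (s := .out (.var 1) (tabS bestE (.var 1))) (ρ := ρ) (σ := (μ', fun _ => 0))
    (fun k τ => τ.1 = μ' ∧ ∀ p < k, τ.2 p = ind (p ∈ S b))
    ⟨rfl, by simp⟩ (by
      rintro k hk ⟨μ, o⟩ ⟨rfl, ho⟩
      refine ⟨rfl, fun p hp => ?_⟩
      have hbest : bestE.eval n l (Function.update ρ 1 k) μ' = b := Function.update_self _ _ _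
      have := entry_lt hb hk
      simp only [Stmt.exec, tabS, entry, eval_load, eval_add, eval_mul, eval_size, eval_var, hbest,
        Function.update_self]
      rcases eq_or_ne p k with rfl | hpk
      · rw [Function.update_self, hμ', Function.update_of_ne (by omega), hS.best b hb p hk]
      · rw [Function.update_of_ne hpk]
        exact ho p (by omega))
  have he' : solve.exec n l ρ (fun _ => 0, fun _ => 0) =
      outputBest.exec n l ρ (μ', fun _ => 0) := by
    rw [solve, Stmt.exec, ← hτ, hτ', Stmt.exec, findLargest, he]
  exact ⟨_, _, S b, he', (hS.isBest b hb (rank_lt hb)).valid, fun I hI =>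
    card_le_of_isBest (fun q hq => hS.isBest q hq (rank_lt hq)) hmax hI, h2.2⟩

end Round

end MixedLabeling

namespace MixedLabeling

open RealRAM

/-! ### The two cases: some labels intersect, or none do. -/

section Final

variable {n : ℕ} {l : List ℝ}

theorem eval_conflictsE_pos {ρ μ : ℕ → ℕ} : 0 < conflictsE.eval n l ρ μ ↔
    ∃ i < n, ∃ j < n, Conf (inX l) (inY n l) i j := by
  simp only [conflictsE, eval_sum, eval_confE, eval_var, Function.update_self,
    Function.update_of_ne (show 20 ≠ 40 by decide), Finset.sum_pos_iff, Finset.mem_range, ind_pos]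

theorem exec_outputAll {ρ μ o : ℕ → ℕ} {p : ℕ} (hp : p < n) :
    (outputAll.exec n l ρ (μ, o)).2 p = 1 :=
  Stmt.exec_loop_induction (n := n) (l := l) (v := 1) (s := .out (.var 1) (.const 1)) (ρ := ρ)
    (σ := (μ, o)) (fun k τ => ∀ p < k, τ.2 p = 1) (by simp) (by
      rintro k hk ⟨μ, o⟩ ho p hp
      simp only [Stmt.exec, eval_const, eval_var, Function.update_self]
      rcases eq_or_ne p k with rfl | hpk
      · exact Function.update_self _ _ _
      · rw [Function.update_of_ne hpk]
        exact ho p (by omega)) p hp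

theorem ready_init (hn : 0 < n) (hl : l.length = 2 * n) : Ready n l [] 1 (State.init n l) where
  vars := by simp
  base := one_pos
  size := by simp [State.init]
  input := rfl
  length := hl
  mem _ := hn

theorem runsIn_of_conf {W : ℕ} (hn : 2 ≤ n) (hW : 8 * (n * n) ≤ W) (hl : l.length = 2 * n)
    (hY : ∀ i < n, ∀ j < n, inY n l i = inY n l j → i = j)
    (hc : ∃ i < n, ∃ j < n, Conf (inX l) (inY n l) i j) :
    ∃ s S, RunsIn W (4 * (n * n)) (algorithm.compile 1) (State.init n l) (algorithm.coef * n ^ 3) s ∧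
      Valid n (inX l) (inY n l) S ∧ (∀ I, Valid n (inX l) (inY n l) I → I.card ≤ S.card) ∧
      ∀ p < n, s.output p = ind (p ∈ S) := by
  have hnW : n < W := by nlinarith
  obtain ⟨s, hr, hs, -⟩ := Stmt.runsIn_compile (by omega) hnW algorithm (ρ := fun _ => 0)
    (ok_algorithm hn hW) (ready_init (by omega) hl) (by simp)
  obtain ⟨μ, o, S, he, hv, hmax, ho⟩ := exec_solve (ρ := fun _ => 0) hn hY
  refine ⟨s, S, hr, hv, hmax, ?_⟩
  have hex : algorithm.exec n l (fun _ => 0)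
      ((State.init n l).natMem, (State.init n l).output) = (μ, o) := by
    have h1 := fun μ => eval_conflictsE_pos (ρ := fun _ => 0) (μ := μ) |>.2 hc
    rw [algorithm, Stmt.exec, Stmt.exec, if_neg, Stmt.exec, if_pos (h1 _)]
    · exact he
    · rw [eval_lt, ind_pos, eval_const, Nat.lt_one_iff]
      exact (h1 _).ne'
  rw [hs.output, hex]
  exact ho

/-- The guard skips `solve`, and the remaining code neither loads nor stores, so memory limit 0
suffices. The two guarded statements are run separately because `algorithm` as a whole does not
satisfy `Ok` with this limit. -/
theorem runsIn_of_not_conf {W : ℕ} (hn : 2 ≤ n) (hW : 8 * (n * n) ≤ W) (hl : l.length = 2 * n)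
    (hc : ¬ ∃ i < n, ∃ j < n, Conf (inX l) (inY n l) i j) :
    ∃ s, RunsIn W 0 (algorithm.compile 1) (State.init n l) (algorithm.coef * n ^ 3) s ∧
      ∀ p < n, s.output p = 1 := by
  have hnW : n < W := by nlinarith
  have hready := ready_init (l := l) (show 0 < n by omega) hl
  obtain ⟨s₁, hr₁, h₁⟩ := Stmt.runsIn_cond_zero (m := 0) (s := solve) (by omega) hnW
    (ok_conflictsE hn hW) hready (eval_conflictsE_pos.not.2 hc)
  have hready₁ := hready.same ⟨h₁.reg, h₁.mem, h₁.input, h₁.output⟩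
  obtain ⟨s₂, hr₂, h₂, -⟩ := Stmt.runsIn_compile (m := 0) (by omega) hnW
    (.cond (.lt conflictsE (.const 1)) outputAll) (ρ := fun _ => 0)
    ⟨⟨ok_conflictsE hn hW, show 1 < W by nlinarith⟩, ok_outputAll hn hW⟩ hready₁ (by simp)
  refine ⟨s₂, (hr₁.seq hr₂).mono ?_, fun p hp => ?_⟩
  · have hpow := Nat.pow_le_pow_right (show 0 < n by omega) (show 2 ≤ 3 by decide)
    have hone : 1 ≤ n ^ 3 := Nat.one_le_pow _ _ (by omega)
    change conflictsE.coef * n ^ 2 + 2 + _ * n ^ 2 ≤ (conflictsE.coef + solve.coef + 2 + _) * n ^ 3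
    nlinarith [Nat.mul_le_mul_left conflictsE.coef hpow, Nat.zero_le (solve.coef * n ^ 3),
      Nat.mul_le_mul_left (Stmt.cond (.lt conflictsE (.const 1)) outputAll).coef hpow]
  · rw [h₂.output, Stmt.exec, if_pos]
    · exact exec_outputAll hp
    · rw [eval_lt, ind_pos, eval_const, Nat.lt_one_iff]
      exact Nat.eq_zero_of_not_pos (eval_conflictsE_pos.not.2 hc)

end Final

end MixedLabeling

/-- One real RAM program, with words of `O(log n)` bits, computes for every set of `n ≥ 2` points with
pairwise distinct `y`-coordinates a mixed labeling with the maximum number of internal labels, in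
`O(n³ log n + n³ δ)` time and `O(n² δ)` working space.  Output cell `i` is `1` if point `i` is labeled
internally and `0` if it is labeled externally. -/
theorem mainTheorem1 :
    ∃ (prog : RealRAM.Program) (C : ℝ) (c : ℕ),
      ∀ (n : ℕ) (P : Fin n → MixedLabeling.Plane),
        2 ≤ n → Function.Injective (fun i => MixedLabeling.yc (P i)) →
        ∃ (t m : ℕ) (s : RealRAM.State) (I E : Finset (Fin n)),
          RealRAM.Runs (n ^ c) m prog
            (RealRAM.State.init n (MixedLabeling.encode P)) t s ∧
          (t : ℝ) ≤ C * ((n : ℝ) ^ 3 * Real.log n + (n : ℝ) ^ 3 * MixedLabeling.density P) ∧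
          (m : ℝ) ≤ C * ((n : ℝ) ^ 2 * MixedLabeling.density P) ∧
          MixedLabeling.IsMaxLabeling P I E ∧
          (∀ i ∈ I, s.output i = 1) ∧ (∀ i ∈ E, s.output i = 0) := by
  open MixedLabeling RealRAM in
  -- The factor 2 absorbs log n ≥ 1/2; the summand 8 turns 4n² cells into 8n²δ by δ ≥ 1/2; the
  -- exponent 5 gives 8n² ≤ n⁵ for n ≥ 2.
  refine ⟨algorithm.compile 1, 2 * algorithm.coef + 8, 5, fun n P hn hP => ?_⟩
  have hn' : (2 : ℝ) ≤ n := by exact_mod_cast hn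
  have hlog : 1 / 2 ≤ Real.log n := by
    have h1 := Real.log_le_log (by norm_num) hn'
    linarith [Real.log_two_gt_d9]
  have hδ := density_nonneg (P := P)
  have hcoef : (0 : ℝ) ≤ algorithm.coef := Nat.cast_nonneg _
  have htime : ∀ t : ℕ, t ≤ algorithm.coef * n ^ 3 →
      (t : ℝ) ≤ (2 * algorithm.coef + 8) * ((n : ℝ) ^ 3 * Real.log n + (n : ℝ) ^ 3 * density P) := by
    intro t ht
    have ht' : (t : ℝ) ≤ algorithm.coef * (n : ℝ) ^ 3 := by exact_mod_cast ht
    have h3 : (0 : ℝ) ≤ (n : ℝ) ^ 3 := by positivity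
    have h4 : (n : ℝ) ^ 3 * (1 / 2) ≤ (n : ℝ) ^ 3 * Real.log n + (n : ℝ) ^ 3 * density P := by
      nlinarith [mul_nonneg h3 hδ, mul_le_mul_of_nonneg_left hlog h3]
    calc (t : ℝ) ≤ algorithm.coef * (n : ℝ) ^ 3 := ht'
      _ ≤ (2 * algorithm.coef + 8) * ((n : ℝ) ^ 3 * (1 / 2)) := by linarith
      _ ≤ _ := mul_le_mul_of_nonneg_left h4 (by linarith)
  have hW : 8 * (n * n) ≤ n ^ 5 := by
    have h := Nat.mul_le_mul_right (n * n) (Nat.pow_le_pow_left hn 3)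
    calc 8 * (n * n) ≤ n ^ 3 * (n * n) := h
      _ = n ^ 5 := by ring
  have hY := inY_injective hP
  by_cases hc : ∃ i < n, ∃ j < n, Conf (inX (encode P)) (inY n (encode P)) i j
  · obtain ⟨s, S, ⟨t, ht, hr⟩, hv, hmax, ho⟩ := runsIn_of_conf hn hW (length_encode P) hY hc
    obtain ⟨i, hi, j, hj, hij⟩ := hc
    have hhalf := half_le_density (i := ⟨i, hi⟩) (j := ⟨j, hj⟩) hn hP hij
    refine ⟨t, 4 * (n * n), s, _, _, hr, htime t ht, ?_, hv.isMaxLabeling hP hmax, ?_, ?_⟩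
    · have h2 : (0 : ℝ) ≤ (n : ℝ) ^ 2 := by positivity
      have h3 := mul_le_mul_of_nonneg_left hhalf h2
      push_cast
      nlinarith [mul_nonneg hcoef (mul_nonneg h2 hδ)]
    · intro i hi
      rw [ho i i.2, ind, if_pos (by simpa using hi)]
    · intro i hi
      rw [ho i i.2, ind, if_neg (by simpa using hi)]
  · obtain ⟨s, ⟨t, ht, hr⟩, ho⟩ := runsIn_of_not_conf hn hW (length_encode P) hc
    -- With no external points there are no leaders, so the absence of label conflicts makes the
    -- full set valid.
    have hv : Valid n (inX (encode P)) (inY n (encode P)) (Finset.range n) :=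
      ⟨fun i hi => Finset.mem_range.1 hi, fun _ _ j hj _ => Finset.mem_range.2 hj,
        fun i hi j hj h => hc ⟨i, Finset.mem_range.1 hi, j, Finset.mem_range.1 hj, h⟩⟩
    have hmax : ∀ I, Valid n (inX (encode P)) (inY n (encode P)) I →
        I.card ≤ (Finset.range n).card := fun I hI =>
      Finset.card_le_card fun p hp => Finset.mem_range.2 (hI.lt p hp)
    refine ⟨t, 0, s, _, _, hr, htime t ht, ?_, hv.isMaxLabeling hP hmax, ?_, ?_⟩
    · rw [Nat.cast_zero]
      positivity
    · exact fun i _ => ho i i.2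
    · intro i hi
      simp at hi
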